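/- **Setting.** Work on $\mathbb R^2$ with complex-valued functions and $\hat u(\xi)=\int e^{-2\pi i x\cdot\xi}u(x)\,dx$. Let $\psi_0\in C^\infty(\mathbb R^2)$ be radial with $0\le\psi_0\le 1$, $\psi_0=1$ on $|\xi|\le 1/2$ and $\operatorname{supp}\psi_0\subset\{|\xi|\le 1\}$; put $\varphi_0(\xi)=\psi_0(\xi/2)-\psi_0(\xi)$ and $\varphi_j(\xi)=\varphi_0(2^{-j}\xi)$ for $j\in\mathbb Z$. Let $\mathcal Z$ be the space of Schwartz functions $u$ with $\partial^\beta\hat u(0)=0$ for every multi-index $\beta$, with the Schwartz topology, and $\mathcal Z'$ its dual (tempered distributions modulo polynomials). For $f\in\mathcal Z'$ let $\Delta_jf=\check\varphi_j*f$, i.e. the function $x\mapsto\langle f,\check\varphi_j(x-\cdot)\rangle$; for functions $F$ let $\Delta_jF=\check\varphi_j*F$. For $s\in\mathbb R$ and $1\le p,q\le\infty$ set $\|f\|_{\dot B^s_{p,q}}=\big\|\big(2^{js}\|\Delta_jf\|_{L^p}\big)_{j\in\mathbb Z}\big\|_{\ell^q}$ and $\dot B^s_{p,q}=\{f\in\mathcal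 Z':\|f\|_{\dot B^s_{p,q}}<\infty\}$. For functions $F,G$ let $[\Delta_j,F]G=\Delta_j(FG)-F\,\Delta_jG$. For $f,g\in\mathcal Z'$, expand $f=\sum_k\Delta_kf$ and $g=\sum_l\Delta_lg$ and let $$[\Delta_j,f]g:=\sum_{(k,l)\in\mathbb Z^2}[\Delta_j,\Delta_kf]\,\Delta_lg .$$ **Statement.** Let $1<p<\infty$, $1\le q\le\infty$, and let $s,t\in\mathbb R$ satisfy $$\frac2p<s<1+\frac2p,\qquad t<\frac2p,\qquad s+t>\frac2p .$$ Then there is a constant $C$, depending only on $p,q,s,t$ and $\psi_0$, such that for all $f\in\dot B^s_{p,q}$ and $g\in\dot B^t_{p,q}$ there is a sequence $(c_j)_{j\in\mathbb Z}$ of nonnegative numbers with $\|(c_j)\|_{\ell^q}\le 1$ such that, for every $j\in\mathbb Z$, the double series defining $[\Delta_j,f]g$ converges unconditionally, both at every point of $\mathbb R^2$ and in $L^p(\mathbb R^2)$, its sum lies in $L^p(\mathbb R^2)$, and $$\big\|[\Delta_j,f]g\big\|_{L^p}\le C\,2^{-(s+t-2/p)j}\,c_j\,\|f\|_{\dot B^s_{p,q}}\,\|g\|_{\dot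 B^t_{p,q}} .$$ Moreover, for Schwartz functions $f,g$ the double series converges unconditionally at every point to $\Delta_j(fg)-f\,\Delta_jg$, so that $[\Delta_j,f]g$ is then the usual commutator. -/

import Mathlib

open MeasureTheory Filter Topology SchwartzMap FourierTransform
open scoped NNReal ENNReal ContDiff

noncomputable section

namespace LittlewoodPaley

/-- The Euclidean plane. -/
abbrev Plane := EuclideanSpace ℝ (Fin 2)

/-- A radial bump function `ψ₀`: smooth, with values in `[0, 1]`, equal to `1` on `|ξ| ≤ 1/2` and
supported in `|ξ| ≤ 1`. -/
structure Bump where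
  toFun : Plane → ℝ
  smooth : ContDiff ℝ ∞ toFun
  radial : ∀ ξ η : Plane, ‖ξ‖ = ‖η‖ → toFun ξ = toFun η
  nonneg : ∀ ξ, 0 ≤ toFun ξ
  le_one : ∀ ξ, toFun ξ ≤ 1
  eq_one : ∀ ξ, ‖ξ‖ ≤ 1 / 2 → toFun ξ = 1
  tsupport_subset : tsupport toFun ⊆ Metric.closedBall 0 1

namespace Bump

variable (ψ : Bump)

/-- `φ₀(ξ) = ψ₀(ξ/2) - ψ₀(ξ)`. -/
def phi0 (ξ : Plane) : ℝ := ψ.toFun ((2 : ℝ)⁻¹ • ξ) - ψ.toFun ξ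

/-- `φⱼ(ξ) = φ₀(2^{-j} ξ)`. -/
def phi (j : ℤ) (ξ : Plane) : ℝ := ψ.phi0 ((2 : ℝ) ^ (-j) • ξ)

theorem toFun_eq_zero {ξ : Plane} (h : 1 < ‖ξ‖) : ψ.toFun ξ = 0 := by
  apply image_eq_zero_of_notMem_tsupport
  intro hm
  have := ψ.tsupport_subset hm
  rw [mem_closedBall_zero_iff] at this
  linarith

theorem contDiff_phi (j : ℤ) : ContDiff ℝ ∞ (fun ξ => (ψ.phi j ξ : ℂ)) := by
  have h0 : ContDiff ℝ ∞ ψ.phi0 :=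
    (ψ.smooth.comp (contDiff_const_smul _)).sub ψ.smooth
  exact Complex.ofRealCLM.contDiff.comp (h0.comp (contDiff_const_smul _))

theorem phi_eq_zero_of_lt (j : ℤ) {ξ : Plane} (h : ‖(2 : ℝ) ^ (-j) • ξ‖ < 1 / 2) :
    ψ.phi j ξ = 0 := by
  have h2 : ‖(2 : ℝ)⁻¹ • ((2 : ℝ) ^ (-j) • ξ)‖ ≤ 1 / 2 := by
    rw [norm_smul, norm_inv, Real.norm_ofNat]
    linarith [norm_nonneg ((2 : ℝ) ^ (-j) • ξ)]
  rw [phi, phi0, ψ.eq_one _ h2, ψ.eq_one _ h.le, sub_self]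

theorem hasCompactSupport_phi (j : ℤ) : HasCompactSupport (fun ξ => (ψ.phi j ξ : ℂ)) := by
  apply HasCompactSupport.intro (isCompact_closedBall (0 : Plane) ((2 : ℝ) ^ j * 2))
  intro ξ hξ
  rw [mem_closedBall_zero_iff, not_le] at hξ
  have hpos : (0 : ℝ) < 2 ^ j := by positivity
  have h1 : 2 < ‖(2 : ℝ) ^ (-j) • ξ‖ := by
    rw [norm_smul, zpow_neg, norm_inv, Real.norm_of_nonneg hpos.le, ← div_eq_inv_mul,
      lt_div_iff₀ hpos]
    linarith
  have h2 : 1 < ‖(2 : ℝ)⁻¹ • ((2 : ℝ) ^ (-j) • ξ)‖ := by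
    rw [norm_smul, norm_inv, Real.norm_ofNat]
    linarith
  rw [phi, phi0, ψ.toFun_eq_zero h2, ψ.toFun_eq_zero (by linarith), sub_self, Complex.ofReal_zero]

/-- `φⱼ` as a Schwartz function. -/
def phiS (j : ℤ) : 𝓢(Plane, ℂ) := (ψ.hasCompactSupport_phi j).toSchwartzMap (ψ.contDiff_phi j)

theorem phiS_apply (j : ℤ) (ξ : Plane) : ψ.phiS j ξ = (ψ.phi j ξ : ℂ) := rfl

/-- The convolution kernel of the `j`-th Littlewood–Paley block: the inverse Fourier transform
of `φⱼ`. -/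
def kernel (j : ℤ) : 𝓢(Plane, ℂ) := 𝓕⁻ (ψ.phiS j)

/-- The reflected and translated kernel `y ↦ (𝓕⁻ φⱼ)(x - y)` as a Schwartz function. -/
def kernelAt (j : ℤ) (x : Plane) : 𝓢(Plane, ℂ) :=
  compSubConstCLM ℂ x
    (compCLMOfContinuousLinearEquiv ℂ (ContinuousLinearEquiv.neg ℝ (M := Plane)) (ψ.kernel j))

theorem kernelAt_apply (j : ℤ) (x y : Plane) : ψ.kernelAt j x y = ψ.kernel j (x - y) := by
  simp [kernelAt]

end Bump

/-- The space `Z` of Schwartz functions all of whose Fourier derivatives vanish at the origin,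
with the topology of the Schwartz space. -/
def Z : Submodule ℂ 𝓢(Plane, ℂ) where
  carrier := {u | ∀ n : ℕ, iteratedFDeriv ℝ n (𝓕 u : 𝓢(Plane, ℂ)) 0 = 0}
  zero_mem' n := by
    have h : (𝓕 (0 : 𝓢(Plane, ℂ)) : 𝓢(Plane, ℂ)) = 0 := FourierTransform.fourier_zero
    simp [h]
  add_mem' {u v} hu hv n := by
    have h : (𝓕 (u + v) : 𝓢(Plane, ℂ)) = 𝓕 u + 𝓕 v := FourierTransform.fourier_add u v
    have h2 : ((𝓕 u + 𝓕 v : 𝓢(Plane, ℂ)) : Plane → ℂ)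
      = ((𝓕 u : 𝓢(Plane, ℂ)) : Plane → ℂ) + ((𝓕 v : 𝓢(Plane, ℂ)) : Plane → ℂ) := rfl
    rw [h, h2, iteratedFDeriv_add ((𝓕 u : 𝓢(Plane, ℂ)).smooth n)
      ((𝓕 v : 𝓢(Plane, ℂ)).smooth n), Pi.add_apply, hu n, hv n, add_zero]
  smul_mem' c {u} hu n := by
    have h : (𝓕 (c • u) : 𝓢(Plane, ℂ)) = c • 𝓕 u := FourierTransform.fourier_smul c u
    have h2 : ((c • 𝓕 u : 𝓢(Plane, ℂ)) : Plane → ℂ)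
      = c • ((𝓕 u : 𝓢(Plane, ℂ)) : Plane → ℂ) := rfl
    rw [h, h2, iteratedFDeriv_const_smul_apply (((𝓕 u : 𝓢(Plane, ℂ)).smooth n).contDiffAt),
      hu n, smul_zero]

/-- The dual `Z'` of `Z`, that is, tempered distributions modulo polynomials. -/
abbrev ZDual := Z →L[ℂ] ℂ

/-- The class in `Z'` of a Schwartz function `F`, acting by `u ↦ ∫ u F`. -/
def ofSchwartz (F : 𝓢(Plane, ℂ)) : ZDual :=
  (integralCLM ℂ volume ∘L pairing (ContinuousLinearMap.mul ℂ ℂ) F) ∘L Z.subtypeL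

theorem ofSchwartz_apply (F : 𝓢(Plane, ℂ)) (u : Z) :
    ofSchwartz F u = ∫ x, (u : 𝓢(Plane, ℂ)) x * F x := by
  simp [ofSchwartz, mul_comm]

namespace Bump

variable (ψ : Bump)

theorem fourier_kernelAt (j : ℤ) (x ξ : Plane) :
    (𝓕 (ψ.kernelAt j x) : 𝓢(Plane, ℂ)) ξ
      = Real.fourierChar (-(inner ℝ x ξ)) • (ψ.phi j (-ξ) : ℂ) := by
  have hk : ∀ η : Plane, 𝓕 (ψ.kernel j : Plane → ℂ) η = (ψ.phi j η : ℂ) := by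
    intro η
    have h : (𝓕 (ψ.kernel j) : 𝓢(Plane, ℂ)) = ψ.phiS j := fourier_fourierInv_eq _
    rw [← SchwartzMap.fourier_coe, h, phiS_apply]
  rw [SchwartzMap.fourier_coe, ← hk, Real.fourier_eq, Real.fourier_eq]
  simp only [Circle.smul_def]
  rw [← integral_smul, ← integral_sub_left_eq_self _ volume x]
  refine integral_congr_ae (Eventually.of_forall fun y => ?_)
  have h : Real.fourierChar (-(inner ℝ (x - y) ξ))
      = Real.fourierChar (-(inner ℝ x ξ)) * Real.fourierChar (-(inner ℝ y (-ξ))) := by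
    rw [← AddChar.map_add_eq_mul]
    congr 1
    rw [inner_sub_left, inner_neg_right]
    ring
  simp only [kernelAt_apply, sub_sub_cancel, h, Circle.coe_mul, smul_eq_mul]
  ring

theorem kernelAt_mem (j : ℤ) (x : Plane) : ψ.kernelAt j x ∈ Z := by
  intro n
  have h : ((𝓕 (ψ.kernelAt j x) : 𝓢(Plane, ℂ)) : Plane → ℂ) =ᶠ[𝓝 0] 0 := by
    have hc : ContinuousAt (fun ξ : Plane => ‖(2 : ℝ) ^ (-j) • (-ξ)‖) 0 := by fun_prop
    have : ∀ᶠ ξ : Plane in 𝓝 0, ‖(2 : ℝ) ^ (-j) • (-ξ)‖ < 1 / 2 :=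
      hc.eventually_lt_const (by simp)
    filter_upwards [this] with ξ hξ
    rw [fourier_kernelAt, ψ.phi_eq_zero_of_lt j hξ]
    simp
  rw [(h.iteratedFDeriv ℝ n).eq_of_nhds]
  simp

/-- The Littlewood–Paley block `Δⱼ f = (𝓕⁻ φⱼ) * f` of `f ∈ Z'`, the function
`x ↦ ⟨f, (𝓕⁻ φⱼ)(x - ·)⟩`. -/
def block (j : ℤ) (f : ZDual) (x : Plane) : ℂ := f ⟨ψ.kernelAt j x, ψ.kernelAt_mem j x⟩

/-- The block `Δⱼ F = (𝓕⁻ φⱼ) * F` of a function `F`. -/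
def blockFun (j : ℤ) (F : Plane → ℂ) (x : Plane) : ℂ := ∫ y, ψ.kernel j (x - y) * F y

/-- The commutator `[Δⱼ, F] G = Δⱼ (F G) - F Δⱼ G` for functions `F` and `G`. -/
def commFun (j : ℤ) (F G : Plane → ℂ) (x : Plane) : ℂ :=
  ψ.blockFun j (fun y => F y * G y) x - F x * ψ.blockFun j G x

/-- The term `[Δⱼ, Δₖ f] Δₗ g` of the Littlewood–Paley expansion of the commutator. -/
def commTerm (j : ℤ) (f g : ZDual) (kl : ℤ × ℤ) : Plane → ℂ :=
  ψ.commFun j (ψ.block kl.1 f) (ψ.block kl.2 g)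

/-- The commutator `[Δⱼ, f] g` for `f, g ∈ Z'`, where `f = ∑ₖ Δₖ f` and `g = ∑ₗ Δₗ g`:
the sum of the double series `∑ₖ ∑ₗ [Δⱼ, Δₖ f] Δₗ g`. -/
def comm (j : ℤ) (f g : ZDual) (x : Plane) : ℂ := ∑' kl : ℤ × ℤ, ψ.commTerm j f g kl x

end Bump

/-- The `ℓ^q` norm, `1 ≤ q ≤ ∞`, of a sequence of extended nonnegative numbers indexed by `ℤ`. -/
def ellNorm (q : ℝ≥0∞) (a : ℤ → ℝ≥0∞) : ℝ≥0∞ :=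
  if q = ⊤ then ⨆ j, a j else (∑' j, a j ^ q.toReal) ^ (1 / q.toReal)

/-- The homogeneous Besov norm: the `ℓ^q` norm of `j ↦ 2^{js} ‖Δⱼ f‖_{L^p}`. -/
def Bump.besovNorm (ψ : Bump) (s : ℝ) (p q : ℝ≥0∞) (f : ZDual) : ℝ≥0∞ :=
  ellNorm q fun j => (2 : ℝ≥0∞) ^ ((j : ℝ) * s) * eLpNorm (ψ.block j f) p volume

/-- The homogeneous Besov space, as a subset of `Z'`. -/
def Bump.besov (ψ : Bump) (s : ℝ) (p q : ℝ≥0∞) : Set ZDual := {f | ψ.besovNorm s p q f < ⊤}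

end LittlewoodPaley

end

noncomputable section

namespace LittlewoodPaley

/-! ### Translations and convolutions under a tempered distribution -/

/-! Fix $j$ and estimate each term $[\Delta_j,\Delta_kf]\Delta_lg$ separately. If $l\ge k+6$, the
product $\Delta_kf\,\Delta_lg$ lives at frequencies of size $2^l$, so the term vanishes unless
$|j-l|\le 3$. There the difference $\Delta_kf(y)-\Delta_kf(x)$ under the integral gains $2^{k-j}$,
because $\Delta_kf$ has Lipschitz constant $\lesssim 2^k\|\Delta_kf\|_\infty$ and the kernel has
width $2^{-j}$ (`enorm_commFun_le`). If $l\le k+5$, no cancellation is needed: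
$\Delta_j(\Delta_kf\,\Delta_lg)$ vanishes unless $j\le k+8$, $\Delta_kf\,\Delta_j\Delta_lg$ vanishes
unless $|j-l|\le 2$, and each is bounded by an $L^p$ norm times a sup norm. Bernstein's inequality
$\|\Delta_kf\|_\infty\lesssim 2^{2k/p}\|\Delta_kf\|_p$ then yields `exists_commTerm_bound`.

In the sum over $(k,l)$ (`exists_tsum_termMajorant_le`) each hypothesis controls one geometric
series: $s>2/p$ handles $k\to+\infty$ and $s<1+2/p$ handles $k\to-\infty$ in the part with $l$ near
$j$; $t<2/p$ handles $l\to-\infty$, and $s+t>2/p$ handles $k\to+\infty$, in the part with $j\le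
k+8$. What remains is $2^{-(s+t-2/p)j}$ times convolutions over $\mathbb Z$ of summable weights with
the Besov sequences of $f$ and $g$, so Young's inequality gives the $\ell^q$ bound. Each term also
obeys a pointwise bound with the same majorant, up to the factor $2^{2j/p}$, whence convergence at
every point.

For $f\in\mathcal Z'$ all this rests on the reproducing formula `block_eq_integral`,
$\Delta_kf=K_k*\Delta_kf$ with $\hat K_k=\varphi_{k-1}+\varphi_k+\varphi_{k+1}$. Bernstein, the
Lipschitz bound and the vanishing of blocks of products all follow from it, so no Fourier transform
of a distribution is ever taken. It comes from extending $f$ to a tempered distribution $T$ and from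
$T(A*H)=\int A(y)\,T(H(\cdot-y))\,dy$ (`apply_convolution`).

For Schwartz functions, $\sum_k\varphi_k=1$ off the origin makes both expansions converge with
summable sup norms, and the sums pass through the convolutions. -/

theorem seminorm_compSubConst_le (u : 𝓢(Plane, ℂ)) (m n : ℕ) :
    ∃ C : ℝ, 0 ≤ C ∧ ∀ y : Plane,
      SchwartzMap.seminorm ℂ m n (compSubConstCLM ℂ y u) ≤ C * (1 + ‖y‖) ^ m := by
  refine ⟨2 ^ m * (Finset.Iic (m, n)).sup (fun i => SchwartzMap.seminorm ℂ i.1 i.2) u,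
    by positivity, fun y => ?_⟩
  refine seminorm_le_bound ℂ m n _ (by positivity) fun z => ?_
  have h1 : iteratedFDeriv ℝ n (compSubConstCLM ℂ y u) z = iteratedFDeriv ℝ n u (z - y) :=
    iteratedFDeriv_comp_sub n y z
  have h2 := one_add_le_sup_seminorm_apply (𝕜 := ℂ) (m := (m, n)) le_rfl le_rfl u (z - y)
  have h3 : ‖z‖ ≤ (1 + ‖z - y‖) * (1 + ‖y‖) := by
    have : ‖z‖ ≤ ‖z - y‖ + ‖y‖ := by simpa using norm_add_le (z - y) y
    nlinarith [norm_nonneg (z - y), norm_nonneg y]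
  rw [h1]
  calc ‖z‖ ^ m * ‖iteratedFDeriv ℝ n u (z - y)‖
      ≤ ((1 + ‖z - y‖) * (1 + ‖y‖)) ^ m * ‖iteratedFDeriv ℝ n u (z - y)‖ := by gcongr
    _ = ((1 + ‖z - y‖) ^ m * ‖iteratedFDeriv ℝ n u (z - y)‖) * (1 + ‖y‖) ^ m := by
      rw [mul_pow]; ring
    _ ≤ _ := by gcongr

/-- Mean value inequality for $D^nu$ on the segment from $z$ to $z-y$, with the weight frozen at
$z$. It serves both continuity of translation and the $L^1$ modulus of continuity of the kernels. -/
theorem seminorm_compSubConst_sub_le (u : 𝓢(Plane, ℂ)) (m n : ℕ) :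
    ∃ C : ℝ, 0 ≤ C ∧ ∀ y : Plane, ‖y‖ ≤ 1 →
      SchwartzMap.seminorm ℂ m n (compSubConstCLM ℂ y u - u) ≤ C * ‖y‖ := by
  obtain ⟨C, hC, h⟩ := seminorm_compSubConst_le u m (n + 1)
  refine ⟨C * 2 ^ m, by positivity, fun y hy => ?_⟩
  refine seminorm_le_bound ℂ m n _ (by positivity) fun z => ?_
  have h1 : iteratedFDeriv ℝ n (compSubConstCLM ℂ y u) z = iteratedFDeriv ℝ n u (z - y) :=
    iteratedFDeriv_comp_sub n y z
  have h2 : iteratedFDeriv ℝ n (compSubConstCLM ℂ y u - u) z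
      = iteratedFDeriv ℝ n u (z - y) - iteratedFDeriv ℝ n u z := by
    rw [← h1]
    exact congrFun (iteratedFDeriv_sub ((compSubConstCLM ℂ y u).smooth n) (u.smooth n)) z
  rw [h2]
  have hd : Differentiable ℝ (iteratedFDeriv ℝ n u) :=
    (u.smooth (n + 1 : ℕ)).differentiable_iteratedFDeriv (by exact_mod_cast Nat.lt_succ_self n)
  rcases (by positivity : 0 ≤ ‖z‖ ^ m).eq_or_lt with hz | hz
  · rw [← hz, zero_mul]
    positivity
  -- A derivative at $z-\theta y$ is a derivative at $z$ of the translate by $\theta y$, whose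
  -- weighted seminorm is at most $C(1+|\theta y|)^m\le C2^m$.
  have hb : ∀ w ∈ segment ℝ z (z - y),
      ‖fderiv ℝ (iteratedFDeriv ℝ n u) w‖ ≤ C * 2 ^ m / ‖z‖ ^ m := by
    intro w hw
    obtain ⟨θ, ⟨h0, h1⟩, rfl⟩ := (segment_eq_image' ℝ z (z - y)).subset hw
    rw [le_div_iff₀' hz, norm_fderiv_iteratedFDeriv]
    have h3 := le_seminorm ℂ m (n + 1) (compSubConstCLM ℂ (θ • y) u) z
    have h4 : iteratedFDeriv ℝ (n + 1) (compSubConstCLM ℂ (θ • y) u) z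
        = iteratedFDeriv ℝ (n + 1) u (z - θ • y) := iteratedFDeriv_comp_sub _ _ z
    have h5 : z + θ • (z - y - z) = z - θ • y := by
      rw [sub_sub_cancel_left, smul_neg, sub_eq_add_neg]
    simp only [h5]
    rw [← h4]
    refine h3.trans ((h _).trans ?_)
    have h6 : ‖θ • y‖ ≤ 1 := by
      rw [norm_smul, Real.norm_of_nonneg h0]
      exact mul_le_one₀ h1 (norm_nonneg _) hy
    gcongr
    linarith
  have h7 := (convex_segment z (z - y)).norm_image_sub_le_of_norm_fderiv_le
    (fun w _ => hd.differentiableAt) hb (left_mem_segment ℝ _ _) (right_mem_segment ℝ _ _)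
  rw [sub_sub_cancel_left, norm_neg] at h7
  calc _ ≤ ‖z‖ ^ m * (C * 2 ^ m / ‖z‖ ^ m * ‖y‖) := by gcongr
    _ = _ := by field_simp

theorem continuous_compSubConst (u : 𝓢(Plane, ℂ)) :
    Continuous fun y : Plane => compSubConstCLM ℂ y u := by
  have h0 : Tendsto (fun y : Plane => compSubConstCLM ℂ y u) (𝓝 0) (𝓝 u) := by
    rw [(schwartz_withSeminorms ℂ Plane ℂ).tendsto_nhds]
    rintro ⟨m, n⟩ ε hε
    obtain ⟨C, hC, h⟩ := seminorm_compSubConst_sub_le u m n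
    have hc : ContinuousAt (fun y : Plane => C * ‖y‖) 0 := by fun_prop
    have h1 : ∀ᶠ y : Plane in 𝓝 0, C * ‖y‖ < ε := hc.eventually_lt_const (by simpa using hε)
    have h2 : ∀ᶠ y : Plane in 𝓝 0, ‖y‖ < 1 :=
      (continuous_norm.continuousAt (x := (0 : Plane))).eventually_lt_const (by simp)
    filter_upwards [h1, h2] with y hy1 hy2
    exact (h y hy2.le).trans_lt hy1
  rw [continuous_iff_continuousAt]
  intro y0
  have h1 : Tendsto (fun y : Plane => y - y0) (𝓝 y0) (𝓝 0) := by
    have : ContinuousAt (fun y : Plane => y - y0) y0 := by fun_prop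
    simpa [ContinuousAt] using this
  have h2 := (((compSubConstCLM (F := ℂ) ℂ y0).continuous.tendsto u).comp h0).comp h1
  refine h2.congr fun y => ?_
  simp

/-! ### Convolution under derivatives and under tempered distributions. -/

open LineDeriv in
theorem lineDerivOp_convolution (A H : 𝓢(Plane, ℂ)) (v : Plane) :
    ∂_{v} (convolution (ContinuousLinearMap.mul ℂ ℂ) A H)
      = convolution (ContinuousLinearMap.mul ℂ ℂ) A (∂_{v} H) := by
  apply (fourierEquiv ℂ 𝓢(Plane, ℂ)).injective
  change 𝓕 (∂_{v} (convolution (ContinuousLinearMap.mul ℂ ℂ) A H))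
    = 𝓕 (convolution (ContinuousLinearMap.mul ℂ ℂ) A (∂_{v} H))
  have ht : (fun x : Plane => inner ℝ x v).HasTemperateGrowth :=
    ((innerSL ℝ).flip v).hasTemperateGrowth
  rw [fourier_lineDerivOp_eq, fourier_convolution, fourier_convolution, fourier_lineDerivOp_eq]
  ext x
  simp [smulLeftCLM_apply_apply ht]
  ring

open LineDeriv in
theorem iteratedLineDerivOp_convolution (A H : 𝓢(Plane, ℂ)) {n : ℕ} (v : Fin n → Plane) :
    ∂^{v} (convolution (ContinuousLinearMap.mul ℂ ℂ) A H)
      = convolution (ContinuousLinearMap.mul ℂ ℂ) A (∂^{v} H) := by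
  induction n with
  | zero => simp
  | succ n ih => rw [iteratedLineDerivOp_succ_left, ih, lineDerivOp_convolution,
      ← iteratedLineDerivOp_succ_left]

theorem integrable_smul_iteratedFDeriv_sub (A H : 𝓢(Plane, ℂ)) (n : ℕ) (z : Plane) :
    Integrable fun y => A y • iteratedFDeriv ℝ n H (z - y) := by
  have hc : Continuous (iteratedFDeriv ℝ n H) :=
    (H.smooth n).continuous_iteratedFDeriv le_rfl
  refine (A.integrable.norm.mul_const (SchwartzMap.seminorm ℂ 0 n H)).mono'
    (A.continuous.smul (hc.comp (by fun_prop))).aestronglyMeasurable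
    (Eventually.of_forall fun y => ?_)
  rw [norm_smul]
  gcongr
  exact norm_iteratedFDeriv_le_seminorm ℂ H n _

/-- All derivatives can be put on the second factor, because on the Fourier side differentiation
multiplies by a scalar symbol. This identifies the vector-valued integral of translates with the
convolution. -/
theorem iteratedFDeriv_convolution (A H : 𝓢(Plane, ℂ)) (n : ℕ) (z : Plane) :
    iteratedFDeriv ℝ n (convolution (ContinuousLinearMap.mul ℂ ℂ) A H) z
      = ∫ y, A y • iteratedFDeriv ℝ n H (z - y) := by
  ext v
  rw [ContinuousMultilinearMap.integral_apply (integrable_smul_iteratedFDeriv_sub A H n z),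
    ← iteratedLineDerivOp_eq_iteratedFDeriv, iteratedLineDerivOp_convolution, convolution_apply,
    MeasureTheory.convolution_def]
  simp [iteratedLineDerivOp_eq_iteratedFDeriv]

/-- Bounded continuous functions on the plane with values in the `n`-linear forms. -/
def BoundedForms (n : ℕ) : Type := BoundedContinuousFunction Plane (Plane [×n]→L[ℝ] ℂ)

namespace BoundedForms

variable {n : ℕ}

instance : NormedAddCommGroup (BoundedForms n) :=
  inferInstanceAs (NormedAddCommGroup (BoundedContinuousFunction Plane (Plane [×n]→L[ℝ] ℂ)))

instance : NormedSpace ℂ (BoundedForms n) :=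
  inferInstanceAs (NormedSpace ℂ (BoundedContinuousFunction Plane (Plane [×n]→L[ℝ] ℂ)))

instance : CompleteSpace (BoundedForms n) :=
  inferInstanceAs (CompleteSpace (BoundedContinuousFunction Plane (Plane [×n]→L[ℝ] ℂ)))

/-- Evaluation at a point. -/
def eval (z : Plane) : BoundedForms n →L[ℂ] Plane [×n]→L[ℝ] ℂ :=
  (BoundedContinuousFunction.evalCLM ℂ z :
    BoundedContinuousFunction Plane (Plane [×n]→L[ℝ] ℂ) →L[ℂ] Plane [×n]→L[ℝ] ℂ)

theorem ext {u v : BoundedForms n} (h : ∀ z, eval z u = eval z v) : u = v :=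
  BoundedContinuousFunction.ext h

theorem norm_le {u : BoundedForms n} {C : ℝ} (hC : 0 ≤ C) (h : ∀ z, ‖eval z u‖ ≤ C) : ‖u‖ ≤ C :=
  (BoundedContinuousFunction.norm_le hC).2 h

theorem norm_eval_le (u : BoundedForms n) (z : Plane) : ‖eval z u‖ ≤ ‖u‖ :=
  BoundedContinuousFunction.norm_coe_le_norm u z

end BoundedForms

/-- The weighted derivative `z ↦ |z|^m D^n u(z)` as a bounded continuous function. -/
def weightedDeriv (m n : ℕ) : 𝓢(Plane, ℂ) →ₗ[ℂ] BoundedForms n where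
  toFun u := BoundedContinuousFunction.ofNormedAddCommGroup
    (fun z => ‖z‖ ^ m • iteratedFDeriv ℝ n u z)
    ((continuous_norm.pow m).smul ((u.smooth n).continuous_iteratedFDeriv le_rfl))
    (SchwartzMap.seminorm ℂ m n u) fun z => by
      rw [norm_smul, norm_pow, norm_norm]
      exact le_seminorm ℂ m n u z
  map_add' u v := by
    refine BoundedForms.ext fun z => ?_
    have : iteratedFDeriv ℝ n (u + v : 𝓢(Plane, ℂ)) z
        = iteratedFDeriv ℝ n u z + iteratedFDeriv ℝ n v z :=
      congrFun (iteratedFDeriv_add (u.smooth n) (v.smooth n)) z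
    change ‖z‖ ^ m • iteratedFDeriv ℝ n (u + v : 𝓢(Plane, ℂ)) z
      = ‖z‖ ^ m • iteratedFDeriv ℝ n u z + ‖z‖ ^ m • iteratedFDeriv ℝ n v z
    rw [this, smul_add]
  map_smul' c u := by
    refine BoundedForms.ext fun z => ?_
    have : iteratedFDeriv ℝ n (c • u : 𝓢(Plane, ℂ)) z = c • iteratedFDeriv ℝ n u z :=
      iteratedFDeriv_const_smul_apply ((u.smooth n).contDiffAt)
    change ‖z‖ ^ m • iteratedFDeriv ℝ n (c • u : 𝓢(Plane, ℂ)) z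
      = c • ‖z‖ ^ m • iteratedFDeriv ℝ n u z
    rw [this, smul_comm]

theorem eval_weightedDeriv (m n : ℕ) (u : 𝓢(Plane, ℂ)) (z : Plane) :
    BoundedForms.eval z (weightedDeriv m n u) = ‖z‖ ^ m • iteratedFDeriv ℝ n u z := rfl

theorem norm_weightedDeriv (m n : ℕ) (u : 𝓢(Plane, ℂ)) :
    ‖weightedDeriv m n u‖ = SchwartzMap.seminorm ℂ m n u := by
  apply le_antisymm
  · refine BoundedForms.norm_le (apply_nonneg _ _) fun z => ?_
    rw [eval_weightedDeriv, norm_smul, norm_pow, norm_norm]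
    exact le_seminorm ℂ m n u z
  · refine seminorm_le_bound ℂ m n u (norm_nonneg (weightedDeriv m n u)) fun z => ?_
    have := (weightedDeriv m n u).norm_eval_le z
    rwa [eval_weightedDeriv, norm_smul, norm_pow, norm_norm] at this

/-- A linear functional dominated by `‖L ·‖` factors through `L` by a bounded functional. -/
theorem exists_clm_comp_eq_of_le {V E : Type*} [AddCommGroup V] [Module ℂ V]
    [NormedAddCommGroup E] [NormedSpace ℂ E] (L : V →ₗ[ℂ] E) (T : V →ₗ[ℂ] ℂ) (C : ℝ)
    (hb : ∀ u, ‖T u‖ ≤ C * ‖L u‖) : ∃ g : E →L[ℂ] ℂ, ∀ u, T u = g (L u) := by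
  have hker : LinearMap.ker L ≤ LinearMap.ker T := by
    intro u hu
    rw [LinearMap.mem_ker] at hu ⊢
    have := hb u
    rw [hu, norm_zero, mul_zero] at this
    exact norm_le_zero_iff.1 this
  obtain ⟨g0, hg0⟩ : ∃ g0 : E →ₗ[ℂ] ℂ, g0 ∘ₗ L = T := by
    -- Over a field the range of the transpose is the annihilator of the kernel. This gives a purely
    -- algebraic factorization; Hahn–Banach then extends its restriction to the range of `L`, where
    -- it is bounded by `C`.
    have h : T ∈ LinearMap.range (L.dualMap) := by
      rw [LinearMap.range_dualMap_eq_dualAnnihilator_ker, Submodule.mem_dualAnnihilator]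
      exact fun u hu => hker hu
    exact h
  let g1 : LinearMap.range L →L[ℂ] ℂ :=
    LinearMap.mkContinuous (g0 ∘ₗ (LinearMap.range L).subtype) C (by
      rintro ⟨_, u, rfl⟩
      have : g0 (L u) = T u := LinearMap.congr_fun hg0 u
      simpa [this] using hb u)
  obtain ⟨g, hg⟩ := StrongDual.exists_extension (LinearMap.range L) g1
  refine ⟨g, fun u => ?_⟩
  have h1 := hg ⟨L u, u, rfl⟩
  have h2 : g1 ⟨L u, u, rfl⟩ = T u := LinearMap.congr_fun hg0 u
  rw [← h2, ← h1]

/-- A tempered distribution factors through finitely many weighted derivatives. -/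
theorem exists_eq_comp_weightedDeriv (T : 𝓢(Plane, ℂ) →L[ℂ] ℂ) :
    ∃ (s : Finset (ℕ × ℕ))
      (g : ((i : s) → BoundedForms i.1.2) →L[ℂ] ℂ),
      ∀ u, T u = g fun i => weightedDeriv i.1.1 i.1.2 u := by
  obtain ⟨s, C, -, hC⟩ := Seminorm.bound_of_continuous
    (schwartz_withSeminorms ℂ Plane ℂ) T.toSeminorm T.continuous.norm
  refine ⟨s, exists_clm_comp_eq_of_le
    (LinearMap.pi fun i : s => weightedDeriv i.1.1 i.1.2) T.toLinearMap C fun u => ?_⟩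
  have h1 : ‖T u‖ ≤ C * (s.sup (schwartzSeminormFamily ℂ Plane ℂ)) u := hC u
  refine h1.trans (mul_le_mul_of_nonneg_left ?_ C.2)
  refine Seminorm.finset_sup_apply_le (norm_nonneg _) fun i hi => ?_
  have h2 := norm_le_pi_norm (fun i : s => weightedDeriv i.1.1 i.1.2 u) ⟨i, hi⟩
  rw [norm_weightedDeriv] at h2
  exact h2

theorem continuous_weightedDeriv_compSubConst (m n : ℕ) (u : 𝓢(Plane, ℂ)) :
    Continuous fun y : Plane => weightedDeriv m n (compSubConstCLM ℂ y u) := by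
  have hL : Continuous (weightedDeriv m n) :=
    (schwartz_withSeminorms ℂ Plane ℂ).continuous_normedSpace_rng
      (BoundedForms n) (weightedDeriv m n)
      ⟨{(m, n)}, 1, fun v => by
        rw [one_smul, Finset.sup_singleton]
        exact (norm_weightedDeriv m n v).le⟩
  exact hL.comp (continuous_compSubConst u)

/-- Seminorms of translates grow at most polynomially, and the decay of `A` absorbs this. The
integral is a Bochner integral in a Banach space, so bounded functionals commute with it. -/
theorem integrable_smul_weightedDeriv (A H : 𝓢(Plane, ℂ)) (m n : ℕ) :
    Integrable fun y : Plane => A y • weightedDeriv m n (compSubConstCLM ℂ y H) := by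
  obtain ⟨C, hC, h⟩ := seminorm_compSubConst_le H m n
  have h1 : Integrable fun y : Plane => (C * 2 ^ m) * (‖A y‖ + ‖y‖ ^ m * ‖A y‖) :=
    (A.integrable.norm.add (A.integrable_pow_mul volume m)).const_mul _
  refine h1.mono' (A.continuous.smul
    (continuous_weightedDeriv_compSubConst m n H)).aestronglyMeasurable
    (Eventually.of_forall fun y => ?_)
  have h2 : (1 + ‖y‖) ^ m ≤ 2 ^ m * (1 + ‖y‖ ^ m) := by
    have h3 : (1 + ‖y‖) ^ m ≤ 2 ^ (m - 1) * (1 ^ m + ‖y‖ ^ m) :=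
      add_pow_le zero_le_one (norm_nonneg y) m
    rw [one_pow] at h3
    refine h3.trans ?_
    gcongr
    · norm_num
    · omega
  refine (norm_smul_le _ _).trans ?_
  rw [norm_weightedDeriv]
  calc ‖A y‖ * _ ≤ ‖A y‖ * (C * (2 ^ m * (1 + ‖y‖ ^ m))) := by
        gcongr
        exact (h y).trans (by gcongr)
    _ = _ := by ring

theorem integral_smul_weightedDeriv (A H : 𝓢(Plane, ℂ)) (m n : ℕ) :
    ∫ y : Plane, A y • weightedDeriv m n (compSubConstCLM ℂ y H)
      = weightedDeriv m n (convolution (ContinuousLinearMap.mul ℂ ℂ) A H) := by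
  refine BoundedForms.ext fun z => ?_
  have h1 := (BoundedForms.eval (n := n) z).integral_comp_comm
    (integrable_smul_weightedDeriv A H m n)
  have h2 : BoundedForms.eval z (∫ y : Plane, A y • weightedDeriv m n (compSubConstCLM ℂ y H))
      = ∫ y : Plane, ‖z‖ ^ m • (A y • iteratedFDeriv ℝ n H (z - y)) := by
    refine h1.symm.trans (integral_congr_ae (Eventually.of_forall fun y => ?_))
    have h3 : iteratedFDeriv ℝ n (compSubConstCLM ℂ y H) z = iteratedFDeriv ℝ n H (z - y) :=
      iteratedFDeriv_comp_sub n y z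
    change BoundedForms.eval z (A y • weightedDeriv m n (compSubConstCLM ℂ y H)) = _
    rw [map_smul, eval_weightedDeriv, h3]
    exact smul_comm _ _ _
  rw [h2, integral_smul, eval_weightedDeriv, iteratedFDeriv_convolution]

/-- A tempered distribution applied to a convolution. -/
theorem apply_convolution (T : 𝓢(Plane, ℂ) →L[ℂ] ℂ) (A H : 𝓢(Plane, ℂ)) :
    T (convolution (ContinuousLinearMap.mul ℂ ℂ) A H)
      = ∫ y, A y * T (compSubConstCLM ℂ y H) := by
  obtain ⟨s, g, hg⟩ := exists_eq_comp_weightedDeriv T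
  have hi : Integrable fun y : Plane =>
      fun i : s => A y • weightedDeriv i.1.1 i.1.2 (compSubConstCLM ℂ y H) :=
    Integrable.of_eval fun i : s => integrable_smul_weightedDeriv A H i.1.1 i.1.2
  have h1 := g.integral_comp_comm hi
  have h2 : (∫ y : Plane, fun i : s => A y • weightedDeriv i.1.1 i.1.2 (compSubConstCLM ℂ y H))
      = fun i : s => weightedDeriv i.1.1 i.1.2 (convolution (ContinuousLinearMap.mul ℂ ℂ) A H) := by
    funext i
    refine (eval_integral (f := fun (y : Plane) (i : s) =>
      A y • weightedDeriv i.1.1 i.1.2 (compSubConstCLM ℂ y H))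
      (fun i : s => integrable_smul_weightedDeriv A H i.1.1 i.1.2) i).trans ?_
    exact integral_smul_weightedDeriv A H i.1.1 i.1.2
  rw [hg, ← h2, ← h1]
  refine integral_congr_ae (Eventually.of_forall fun y => ?_)
  beta_reduce
  rw [hg]
  exact g.map_smul (A y) _

/-! ### Frequency supports and the reproducing formula for the blocks -/

theorem fourier_compSubConst (u : 𝓢(Plane, ℂ)) (x ξ : Plane) :
    (𝓕 (compSubConstCLM ℂ x u) : 𝓢(Plane, ℂ)) ξ
      = Real.fourierChar (-(inner ℝ x ξ)) • (𝓕 u : 𝓢(Plane, ℂ)) ξ := by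
  rw [SchwartzMap.fourier_coe, SchwartzMap.fourier_coe, Real.fourier_eq, Real.fourier_eq]
  simp only [Circle.smul_def]
  rw [← integral_smul, ← integral_add_right_eq_self _ x]
  refine integral_congr_ae (Eventually.of_forall fun y => ?_)
  have h : Real.fourierChar (-(inner ℝ (y + x) ξ))
      = Real.fourierChar (-(inner ℝ x ξ)) * Real.fourierChar (-(inner ℝ y ξ)) := by
    rw [← AddChar.map_add_eq_mul, inner_add_left]
    congr 1
    ring
  simp only [compSubConstCLM_apply, add_sub_cancel_right, h, Circle.coe_mul, smul_eq_mul]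
  ring

theorem fourier_fourier_apply (u : 𝓢(Plane, ℂ)) (x : Plane) :
    (𝓕 (𝓕 u : 𝓢(Plane, ℂ)) : 𝓢(Plane, ℂ)) x = u (-x) := by
  have h : 𝓕⁻ (𝓕 u : 𝓢(Plane, ℂ)) = u := fourierInv_fourier_eq u
  conv_rhs => rw [← h]
  rw [SchwartzMap.fourierInv_coe, SchwartzMap.fourier_coe, Real.fourierInv_eq_fourier_neg, neg_neg]

/-- Obtained from the convolution theorem by one more Fourier transform, both sides then being
reflected products. -/
theorem fourier_pairing (u v : 𝓢(Plane, ℂ)) :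
    𝓕 (pairing (ContinuousLinearMap.mul ℂ ℂ) u v)
      = SchwartzMap.convolution (ContinuousLinearMap.mul ℂ ℂ) (𝓕 u) (𝓕 v) := by
  apply (fourierEquiv ℂ 𝓢(Plane, ℂ)).injective
  change 𝓕 (𝓕 (pairing (ContinuousLinearMap.mul ℂ ℂ) u v))
    = 𝓕 (SchwartzMap.convolution (ContinuousLinearMap.mul ℂ ℂ) (𝓕 u) (𝓕 v))
  rw [fourier_convolution]
  ext x
  simp [fourier_fourier_apply]

theorem fourier_pairing_eq_zero (u v : 𝓢(Plane, ℂ)) (ξ : Plane)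
    (h : ∀ η, (𝓕 u : 𝓢(Plane, ℂ)) η = 0 ∨ (𝓕 v : 𝓢(Plane, ℂ)) (ξ - η) = 0) :
    (𝓕 (pairing (ContinuousLinearMap.mul ℂ ℂ) u v) : 𝓢(Plane, ℂ)) ξ = 0 := by
  rw [fourier_pairing, convolution_apply, MeasureTheory.convolution_def]
  refine integral_eq_zero_of_ae (Eventually.of_forall fun η => ?_)
  simpa using h η

namespace Bump

variable (ψ : Bump)

theorem fourier_kernel (j : ℤ) : 𝓕 (ψ.kernel j) = ψ.phiS j := fourier_fourierInv_eq _

theorem blockFun_schwartz (j : ℤ) (u : 𝓢(Plane, ℂ)) (x : Plane) :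
    ψ.blockFun j u x = SchwartzMap.convolution (ContinuousLinearMap.mul ℂ ℂ) (ψ.kernel j) u x := by
  rw [convolution_apply, MeasureTheory.convolution_def, blockFun,
    ← integral_sub_left_eq_self _ volume x]
  simp

theorem blockFun_schwartz_eq_zero (j : ℤ) (u : 𝓢(Plane, ℂ)) (x : Plane)
    (h : ∀ ξ, ψ.phi j ξ = 0 ∨ (𝓕 u : 𝓢(Plane, ℂ)) ξ = 0) : ψ.blockFun j u x = 0 := by
  rw [blockFun_schwartz]
  have h0 : SchwartzMap.convolution (ContinuousLinearMap.mul ℂ ℂ) (ψ.kernel j) u = 0 := by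
    apply (fourierEquiv ℂ 𝓢(Plane, ℂ)).injective
    rw [map_zero]
    change 𝓕 (SchwartzMap.convolution (ContinuousLinearMap.mul ℂ ℂ) (ψ.kernel j) u) = 0
    rw [fourier_convolution, fourier_kernel]
    ext ξ
    simpa [phiS_apply] using h ξ
  simp [h0]

theorem lt_norm_of_phi_ne_zero {j : ℤ} {ξ : Plane} (h : ψ.phi j ξ ≠ 0) :
    (2 : ℝ) ^ (j - 1) < ‖ξ‖ := by
  by_contra! hle
  apply h
  have hpos : (0 : ℝ) < 2 ^ j := by positivity
  have hη : ‖(2 : ℝ) ^ (-j) • ξ‖ ≤ 1 / 2 := by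
    rw [norm_smul, zpow_neg, norm_inv, Real.norm_of_nonneg hpos.le, ← div_eq_inv_mul,
      div_le_iff₀ hpos]
    rw [zpow_sub_one₀ two_ne_zero] at hle
    linarith
  have h2 : ‖(2 : ℝ)⁻¹ • ((2 : ℝ) ^ (-j) • ξ)‖ ≤ 1 / 2 := by
    rw [norm_smul, norm_inv, Real.norm_ofNat]
    linarith [norm_nonneg ((2 : ℝ) ^ (-j) • ξ)]
  rw [phi, phi0, ψ.eq_one _ h2, ψ.eq_one _ hη, sub_self]

theorem norm_le_of_phi_ne_zero {j : ℤ} {ξ : Plane} (h : ψ.phi j ξ ≠ 0) :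
    ‖ξ‖ ≤ (2 : ℝ) ^ (j + 1) := by
  by_contra! hlt
  apply h
  have hpos : (0 : ℝ) < 2 ^ j := by positivity
  have hη : 2 < ‖(2 : ℝ) ^ (-j) • ξ‖ := by
    rw [norm_smul, zpow_neg, norm_inv, Real.norm_of_nonneg hpos.le, ← div_eq_inv_mul,
      lt_div_iff₀ hpos]
    rw [zpow_add_one₀ two_ne_zero] at hlt
    linarith
  have h2 : 1 < ‖(2 : ℝ)⁻¹ • ((2 : ℝ) ^ (-j) • ξ)‖ := by
    rw [norm_smul, norm_inv, Real.norm_ofNat]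
    linarith
  rw [phi, phi0, ψ.toFun_eq_zero h2, ψ.toFun_eq_zero (by linarith), sub_self]

/-- `φₖ₋₁ + φₖ + φₖ₊₁`, which is `1` on the support of `φₖ`. -/
def fatPhi (k : ℤ) (ξ : Plane) : ℝ := ψ.phi (k - 1) ξ + ψ.phi k ξ + ψ.phi (k + 1) ξ

theorem phi_eq_sub (j : ℤ) (ξ : Plane) :
    ψ.phi j ξ = ψ.toFun ((2 : ℝ) ^ (-(j + 1)) • ξ) - ψ.toFun ((2 : ℝ) ^ (-j) • ξ) := by
  rw [phi, phi0, smul_smul]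
  congr 3
  rw [neg_add, zpow_add₀ two_ne_zero, zpow_neg_one, mul_comm]

theorem toFun_zpow_smul_eq_one {j : ℤ} {ξ : Plane} (h : ‖ξ‖ ≤ (2 : ℝ) ^ (j - 1)) :
    ψ.toFun ((2 : ℝ) ^ (-j) • ξ) = 1 := by
  apply ψ.eq_one
  have hpos : (0 : ℝ) < 2 ^ j := by positivity
  rw [norm_smul, zpow_neg, norm_inv, Real.norm_of_nonneg hpos.le, ← div_eq_inv_mul,
    div_le_iff₀ hpos]
  rw [zpow_sub_one₀ two_ne_zero] at h
  linarith

theorem toFun_zpow_smul_eq_zero {j : ℤ} {ξ : Plane} (h : (2 : ℝ) ^ j < ‖ξ‖) :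
    ψ.toFun ((2 : ℝ) ^ (-j) • ξ) = 0 := by
  apply ψ.toFun_eq_zero
  have hpos : (0 : ℝ) < 2 ^ j := by positivity
  rwa [norm_smul, zpow_neg, norm_inv, Real.norm_of_nonneg hpos.le, ← div_eq_inv_mul,
    lt_div_iff₀ hpos, one_mul]

/-- The three pieces telescope to $\psi_0(2^{-(k+2)}\xi)-\psi_0(2^{-(k-1)}\xi)$, which is $1-0$
wherever $\varphi_k\ne0$. -/
theorem fatPhi_mul_phi (k : ℤ) (ξ : Plane) : ψ.fatPhi k ξ * ψ.phi k ξ = ψ.phi k ξ := by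
  by_cases h : ψ.phi k ξ = 0
  · rw [h, mul_zero]
  · have h1 : ψ.toFun ((2 : ℝ) ^ (-(k + 2)) • ξ) = 1 := by
      apply ψ.toFun_zpow_smul_eq_one
      have := ψ.norm_le_of_phi_ne_zero h
      rwa [show k + 2 - 1 = k + 1 by ring]
    have h2 : ψ.toFun ((2 : ℝ) ^ (-(k - 1)) • ξ) = 0 :=
      ψ.toFun_zpow_smul_eq_zero (ψ.lt_norm_of_phi_ne_zero h)
    have h3 : ψ.fatPhi k ξ = 1 := by
      rw [fatPhi, phi_eq_sub, phi_eq_sub, phi_eq_sub, h2, sub_add_cancel,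
        show k + 1 + 1 = k + 2 by ring, h1]
      ring
    rw [h3, one_mul]

theorem lt_norm_of_fatPhi_ne_zero {k : ℤ} {ξ : Plane} (h : ψ.fatPhi k ξ ≠ 0) :
    (2 : ℝ) ^ (k - 2) < ‖ξ‖ := by
  by_contra! hle
  have h0 : ∀ i : ℤ, k - 1 ≤ i → ψ.phi i ξ = 0 := by
    intro i hi
    by_contra hne
    have h1 := ψ.lt_norm_of_phi_ne_zero hne
    have h2 : (2 : ℝ) ^ (k - 2) ≤ 2 ^ (i - 1) := zpow_le_zpow_right₀ one_le_two (by omega)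
    linarith
  apply h
  rw [fatPhi, h0 _ le_rfl, h0 k (by omega), h0 (k + 1) (by omega)]
  norm_num

theorem norm_le_of_fatPhi_ne_zero {k : ℤ} {ξ : Plane} (h : ψ.fatPhi k ξ ≠ 0) :
    ‖ξ‖ ≤ (2 : ℝ) ^ (k + 2) := by
  by_contra! hlt
  have h0 : ∀ i : ℤ, i ≤ k + 1 → ψ.phi i ξ = 0 := by
    intro i hi
    by_contra hne
    have h1 := ψ.norm_le_of_phi_ne_zero hne
    have h2 : (2 : ℝ) ^ (i + 1) ≤ 2 ^ (k + 2) := zpow_le_zpow_right₀ one_le_two (by omega)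
    linarith
  apply h
  rw [fatPhi, h0 _ le_rfl, h0 k (by omega), h0 (k - 1) (by omega)]
  norm_num

/-- The convolution kernel whose Fourier transform is `fatPhi k`. -/
def fatKernel (k : ℤ) : 𝓢(Plane, ℂ) := ψ.kernel (k - 1) + ψ.kernel k + ψ.kernel (k + 1)

theorem fourier_fatKernel (k : ℤ) (ξ : Plane) :
    (𝓕 (ψ.fatKernel k) : 𝓢(Plane, ℂ)) ξ = (ψ.fatPhi k ξ : ℂ) := by
  have h : 𝓕 (ψ.fatKernel k) = ψ.phiS (k - 1) + ψ.phiS k + ψ.phiS (k + 1) := by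
    rw [fatKernel, FourierTransform.fourier_add, FourierTransform.fourier_add, fourier_kernel,
      fourier_kernel, fourier_kernel]
  rw [h]
  simp [phiS_apply, fatPhi]

/-- The function `y ↦ fatKernel k (x - y)`. -/
def fatKernelAt (k : ℤ) (x : Plane) : 𝓢(Plane, ℂ) :=
  ψ.kernelAt (k - 1) x + ψ.kernelAt k x + ψ.kernelAt (k + 1) x

theorem fatKernelAt_apply (k : ℤ) (x y : Plane) :
    ψ.fatKernelAt k x y = ψ.fatKernel k (x - y) := by
  simp [fatKernelAt, fatKernel, kernelAt_apply]

theorem kernelAt_eq_convolution (k : ℤ) (x : Plane) :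
    ψ.kernelAt k x
      = SchwartzMap.convolution (ContinuousLinearMap.mul ℂ ℂ) (ψ.fatKernelAt k x)
        (ψ.kernelAt k 0) := by
  apply (fourierEquiv ℂ 𝓢(Plane, ℂ)).injective
  change 𝓕 (ψ.kernelAt k x)
    = 𝓕 (SchwartzMap.convolution (ContinuousLinearMap.mul ℂ ℂ) (ψ.fatKernelAt k x) (ψ.kernelAt k 0))
  rw [fourier_convolution, fatKernelAt, FourierTransform.fourier_add,
    FourierTransform.fourier_add]
  ext ξ
  have h := congrArg (fun r : ℝ => (r : ℂ)) (ψ.fatPhi_mul_phi k (-ξ))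
  simp only [fatPhi, Complex.ofReal_mul, Complex.ofReal_add] at h
  simp only [pairing_apply_apply, add_apply, fourier_kernelAt, ContinuousLinearMap.mul_apply',
    inner_zero_left, neg_zero, AddChar.map_zero_eq_one, one_smul, Circle.smul_def, smul_eq_mul]
  linear_combination -(Real.fourierChar (-(inner ℝ x ξ)) : ℂ) * h

theorem compSubConst_kernelAt_zero (k : ℤ) (x : Plane) :
    compSubConstCLM ℂ x (ψ.kernelAt k 0) = ψ.kernelAt k x := by
  ext y
  simp [kernelAt_apply]

/-- Hahn–Banach. The choice of extension is immaterial, since blocks test `f` only on kernels lying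
in `Z`. -/
theorem exists_extension_block (f : ZDual) :
    ∃ T : 𝓢(Plane, ℂ) →L[ℂ] ℂ, ∀ k x, ψ.block k f x = T (ψ.kernelAt k x) := by
  have : PolynormableSpace ℂ 𝓢(Plane, ℂ) :=
    (schwartz_withSeminorms ℂ Plane ℂ).toPolynormableSpace
  obtain ⟨T, hT⟩ := StrongDual.exists_extension Z f
  exact ⟨T, fun k x => (hT ⟨ψ.kernelAt k x, ψ.kernelAt_mem k x⟩).symm⟩

theorem continuous_block (k : ℤ) (f : ZDual) : Continuous (ψ.block k f) := by
  obtain ⟨T, hT⟩ := ψ.exists_extension_block f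
  have h : ψ.block k f = fun x => T (compSubConstCLM ℂ x (ψ.kernelAt k 0)) := by
    funext x
    rw [hT, compSubConst_kernelAt_zero]
  rw [h]
  exact T.continuous.comp (continuous_compSubConst _)

/-- The extension is applied to `kernelAt_eq_convolution`: the translates of the thin kernel
reappear as the values of the block itself. -/
theorem block_eq_integral (k : ℤ) (f : ZDual) (x : Plane) :
    ψ.block k f x = ∫ y, ψ.fatKernel k (x - y) * ψ.block k f y := by
  obtain ⟨T, hT⟩ := ψ.exists_extension_block f
  simp only [hT]
  rw [kernelAt_eq_convolution, apply_convolution]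
  simp only [compSubConst_kernelAt_zero, fatKernelAt_apply]

end Bump

/-! ### Vanishing of blocks of products -/

/-- Insert $u=K*u$ and use Fubini. This reduces the vanishing of integrals against a bounded block
to the same statement for a translated Schwartz kernel, where Fourier supports are available. -/
theorem integral_mul_eq_zero_of_reproducing {u : Plane → ℂ} (hu : Continuous u) {M : ℝ}
    (hM : ∀ x, ‖u x‖ ≤ M) (K : 𝓢(Plane, ℂ)) (hK : ∀ x, u x = ∫ y, K (x - y) * u y)
    {w : Plane → ℂ} (hw : Integrable w) (h : ∀ z, ∫ y, w y * K (y - z) = 0) :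
    ∫ y, w y * u y = 0 := by
  have h1 : Integrable (fun p : Plane × Plane => w p.1 * K (p.1 - p.2)) (volume.prod volume) := by
    have h2 := (hw.convolution_integrand (ContinuousLinearMap.mul ℂ ℂ)
      (K.integrable (μ := volume)).comp_neg).swap
    refine h2.congr (Eventually.of_forall fun p => ?_)
    simp [Prod.swap]
  have h3 : Integrable (fun p : Plane × Plane => w p.1 * K (p.1 - p.2) * u p.2)
      (volume.prod volume) :=
    h1.mul_bdd (hu.comp continuous_snd).aestronglyMeasurable
      (Eventually.of_forall fun p => hM p.2)
  calc ∫ y, w y * u y = ∫ y, ∫ z, w y * K (y - z) * u z := by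
        refine integral_congr_ae (Eventually.of_forall fun y => ?_)
        simp only [mul_assoc]
        rw [integral_const_mul, ← hK]
    _ = ∫ z, ∫ y, w y * K (y - z) * u z := integral_integral_swap h3
    _ = 0 := by simp only [integral_mul_const, h, zero_mul, integral_zero]

theorem integrable_schwartz_mul_sub (A B : 𝓢(Plane, ℂ)) (x z : Plane) :
    Integrable fun y => A (x - y) * B (y - z) := by
  refine (A.integrable.comp_sub_left x).mul_bdd (g := fun y => B (y - z))
    (c := SchwartzMap.seminorm ℂ 0 0 B)
    (B.continuous.comp (by fun_prop)).aestronglyMeasurable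
    (Eventually.of_forall fun y => norm_le_seminorm ℂ B _)

namespace Bump

variable (ψ : Bump)

theorem integral_kernel_mul_fatKernel_eq_zero {j l : ℤ}
    (h : ∀ ξ, ψ.phi j ξ = 0 ∨ ψ.fatPhi l ξ = 0) (x z : Plane) :
    ∫ y, ψ.kernel j (x - y) * ψ.fatKernel l (y - z) = 0 := by
  have := ψ.blockFun_schwartz_eq_zero j (compSubConstCLM ℂ z (ψ.fatKernel l)) x fun ξ => by
    rw [fourier_compSubConst, fourier_fatKernel]
    rcases h ξ with h | h
    · exact Or.inl h
    · right
      rw [h, Complex.ofReal_zero, smul_zero]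
  exact this

theorem integral_kernel_mul_fatKernel_mul_fatKernel_eq_zero {j k l : ℤ}
    (h : ∀ η ζ, ψ.fatPhi k η ≠ 0 → ψ.fatPhi l ζ ≠ 0 → ψ.phi j (η + ζ) = 0) (x z w : Plane) :
    ∫ y, ψ.kernel j (x - y) * ψ.fatKernel k (y - z) * ψ.fatKernel l (y - w) = 0 := by
  have := ψ.blockFun_schwartz_eq_zero j
    (pairing (ContinuousLinearMap.mul ℂ ℂ) (compSubConstCLM ℂ z (ψ.fatKernel k))
      (compSubConstCLM ℂ w (ψ.fatKernel l))) x fun ξ => by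
    by_cases hξ : ψ.phi j ξ = 0
    · exact Or.inl hξ
    refine Or.inr (fourier_pairing_eq_zero _ _ _ fun η => ?_)
    rw [fourier_compSubConst, fourier_fatKernel, fourier_compSubConst, fourier_fatKernel]
    by_contra! hne
    refine hξ ?_
    rw [← add_sub_cancel η ξ]
    refine h _ _ (fun h0 => hne.1 ?_) (fun h0 => hne.2 ?_) <;>
    rw [h0, Complex.ofReal_zero, smul_zero]
  simpa [blockFun, mul_assoc] using this

variable {f g : ZDual}

theorem integrable_kernel_mul (j : ℤ) (x : Plane) {u : Plane → ℂ} (hu : Continuous u) {M : ℝ}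
    (hM : ∀ x, ‖u x‖ ≤ M) : Integrable fun y => ψ.kernel j (x - y) * u y :=
  ((ψ.kernel j).integrable.comp_sub_left x).mul_bdd hu.aestronglyMeasurable
    (Eventually.of_forall hM)

theorem blockFun_block_eq_zero {j l : ℤ} {M : ℝ} (hM : ∀ x, ‖ψ.block l g x‖ ≤ M)
    (h : ∀ ξ, ψ.phi j ξ = 0 ∨ ψ.fatPhi l ξ = 0) (x : Plane) :
    ψ.blockFun j (ψ.block l g) x = 0 :=
  integral_mul_eq_zero_of_reproducing (ψ.continuous_block l g) hM (ψ.fatKernel l)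
    (ψ.block_eq_integral l g) ((ψ.kernel j).integrable.comp_sub_left x)
    (ψ.integral_kernel_mul_fatKernel_eq_zero h x)

theorem blockFun_block_mul_block_eq_zero {j k l : ℤ} {M N : ℝ}
    (hM : ∀ x, ‖ψ.block k f x‖ ≤ M) (hN : ∀ x, ‖ψ.block l g x‖ ≤ N)
    (h : ∀ η ζ, ψ.fatPhi k η ≠ 0 → ψ.fatPhi l ζ ≠ 0 → ψ.phi j (η + ζ) = 0) (x : Plane) :
    ψ.blockFun j (fun y => ψ.block k f y * ψ.block l g y) x = 0 := by
  have h1 : ∀ z, ∫ y, ψ.kernel j (x - y) * ψ.fatKernel k (y - z) * ψ.block l g y = 0 := fun z =>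
    integral_mul_eq_zero_of_reproducing (ψ.continuous_block l g) hN (ψ.fatKernel l)
      (ψ.block_eq_integral l g) (integrable_schwartz_mul_sub _ _ x z)
      (ψ.integral_kernel_mul_fatKernel_mul_fatKernel_eq_zero h x z)
  -- The two blocks are replaced by kernels one after the other: `h1` has dealt with $\Delta_lg$,
  -- and now $\Delta_kf$ is treated with $\Delta_lg$ kept in the weight.
  have h2 := integral_mul_eq_zero_of_reproducing (ψ.continuous_block k f) hM (ψ.fatKernel k)
    (ψ.block_eq_integral k f) (ψ.integrable_kernel_mul j x (ψ.continuous_block l g) hN)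
    (fun z => by rw [← h1 z]; congr 1; funext y; ring)
  rw [blockFun, ← h2]
  congr 1
  funext y
  ring

theorem blockFun_block_eq_zero_of_far {j l : ℤ} {M : ℝ} (hM : ∀ x, ‖ψ.block l g x‖ ≤ M)
    (h : 3 ≤ |j - l|) (x : Plane) : ψ.blockFun j (ψ.block l g) x = 0 := by
  refine ψ.blockFun_block_eq_zero hM (fun ξ => ?_) x
  by_contra! hne
  have h1 := ψ.lt_norm_of_phi_ne_zero hne.1
  have h2 := ψ.norm_le_of_phi_ne_zero hne.1
  have h3 := ψ.lt_norm_of_fatPhi_ne_zero hne.2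
  have h4 := ψ.norm_le_of_fatPhi_ne_zero hne.2
  have h5 := (zpow_lt_zpow_iff_right₀ (one_lt_two (α := ℝ))).1 (h1.trans_le h4)
  have h6 := (zpow_lt_zpow_iff_right₀ (one_lt_two (α := ℝ))).1 (h3.trans_le h2)
  rcases le_abs.1 h with h | h <;> omega

theorem blockFun_block_mul_block_eq_zero_of_low_high {j k l : ℤ} {M N : ℝ}
    (hM : ∀ x, ‖ψ.block k f x‖ ≤ M) (hN : ∀ x, ‖ψ.block l g x‖ ≤ N) (hkl : k + 6 ≤ l)
    (h : 4 ≤ |j - l|) (x : Plane) :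
    ψ.blockFun j (fun y => ψ.block k f y * ψ.block l g y) x = 0 := by
  refine ψ.blockFun_block_mul_block_eq_zero hM hN (fun η ζ hη hζ => ?_) x
  by_contra hne
  have h1 := ψ.lt_norm_of_phi_ne_zero hne
  have h2 := ψ.norm_le_of_phi_ne_zero hne
  have h3 := ψ.lt_norm_of_fatPhi_ne_zero hζ
  have h4 := ψ.norm_le_of_fatPhi_ne_zero hζ
  have h5 := ψ.norm_le_of_fatPhi_ne_zero hη
  -- The gap of 6 makes $|\eta|\le\frac14\cdot2^{l-2}$, less than a quarter of $|\zeta|$. In units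
  -- of $2^{l-4}$, $|\eta+\zeta|$ lies between 3 and 65, hence between $2^{l-3}$ and $2^{l+3}$.
  have h6 : (2 : ℝ) ^ (k + 2) ≤ 2 ^ (l - 4) := zpow_le_zpow_right₀ one_le_two (by omega)
  have hp : (0 : ℝ) < 2 ^ (l - 4) := by positivity
  have e1 : (2 : ℝ) ^ (l - 2) = 4 * 2 ^ (l - 4) := by
    rw [show l - 2 = l - 4 + 2 by ring, zpow_add₀ two_ne_zero]; norm_num; ring
  have e2 : (2 : ℝ) ^ (l + 2) = 64 * 2 ^ (l - 4) := by
    rw [show l + 2 = l - 4 + 6 by ring, zpow_add₀ two_ne_zero]; norm_num; ring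
  have e3 : (2 : ℝ) ^ (l + 3) = 128 * 2 ^ (l - 4) := by
    rw [show l + 3 = l - 4 + 7 by ring, zpow_add₀ two_ne_zero]; norm_num; ring
  have e4 : (2 : ℝ) ^ (l - 3) = 2 * 2 ^ (l - 4) := by
    rw [show l - 3 = l - 4 + 1 by ring, zpow_add₀ two_ne_zero]; norm_num; ring
  have h7 := norm_add_le η ζ
  have h8 : ‖ζ‖ ≤ ‖η + ζ‖ + ‖η‖ := by
    have := norm_sub_le (η + ζ) η
    rwa [add_sub_cancel_left] at this
  have h9 : (2 : ℝ) ^ (j - 1) < 2 ^ (l + 3) := by linarith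
  have h10 : (2 : ℝ) ^ (l - 3) < 2 ^ (j + 1) := by linarith
  have h11 := (zpow_lt_zpow_iff_right₀ (one_lt_two (α := ℝ))).1 h9
  have h12 := (zpow_lt_zpow_iff_right₀ (one_lt_two (α := ℝ))).1 h10
  rcases le_abs.1 h with h | h <;> omega

theorem blockFun_block_mul_block_eq_zero_of_high {j k l : ℤ} {M N : ℝ}
    (hM : ∀ x, ‖ψ.block k f x‖ ≤ M) (hN : ∀ x, ‖ψ.block l g x‖ ≤ N) (hkl : l ≤ k + 5)
    (h : k + 9 ≤ j) (x : Plane) :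
    ψ.blockFun j (fun y => ψ.block k f y * ψ.block l g y) x = 0 := by
  refine ψ.blockFun_block_mul_block_eq_zero hM hN (fun η ζ hη hζ => ?_) x
  by_contra hne
  have h1 := ψ.lt_norm_of_phi_ne_zero hne
  have h4 := ψ.norm_le_of_fatPhi_ne_zero hζ
  have h5 := ψ.norm_le_of_fatPhi_ne_zero hη
  have h6 : (2 : ℝ) ^ (l + 2) ≤ 2 ^ (k + 7) := zpow_le_zpow_right₀ one_le_two (by omega)
  have h7 : (2 : ℝ) ^ (k + 2) ≤ 2 ^ (k + 7) := zpow_le_zpow_right₀ one_le_two (by omega)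
  have h8 : (2 : ℝ) ^ (k + 8) ≤ 2 ^ (j - 1) := zpow_le_zpow_right₀ one_le_two (by omega)
  have e1 : (2 : ℝ) ^ (k + 8) = 2 * 2 ^ (k + 7) := by
    rw [show k + 8 = k + 7 + 1 by ring, zpow_add₀ two_ne_zero]; norm_num; ring
  linarith [norm_add_le η ζ]

end Bump

/-! ### Convolution inequalities -/

section Young

variable {α : Type*} [MeasurableSpace α] {μ : Measure α}

/-- Hölder after splitting $hv=h^{1/q}\cdot h^{1/p}v$, that is, Jensen's inequality for the weight
$h$. -/
theorem lintegral_mul_rpow_le {p : ℝ} (hp : 1 ≤ p) {h v : α → ℝ≥0∞} (hh : AEMeasurable h μ)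
    (hv : AEMeasurable v μ) :
    (∫⁻ y, h y * v y ∂μ) ^ p ≤ (∫⁻ y, h y ∂μ) ^ (p - 1) * ∫⁻ y, h y * v y ^ p ∂μ := by
  rcases hp.eq_or_lt with rfl | hp
  · simp
  have hpq := Real.HolderConjugate.conjExponent hp
  set q := p.conjExponent
  have h1 := ENNReal.lintegral_mul_le_Lp_mul_Lq μ hpq.symm
    (f := fun y => h y ^ (1 / q)) (g := fun y => h y ^ (1 / p) * v y)
    (hh.pow_const _) ((hh.pow_const _).mul hv)
  have e1 : ∀ y, ((fun y => h y ^ (1 / q)) * fun y => h y ^ (1 / p) * v y) y = h y * v y := by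
    intro y
    rw [Pi.mul_apply, ← mul_assoc, ← ENNReal.rpow_add_of_nonneg _ _
      (one_div_nonneg.2 hpq.symm.nonneg)
      (one_div_nonneg.2 hpq.nonneg), one_div, one_div, hpq.symm.inv_add_inv_eq_one,
      ENNReal.rpow_one]
  have e2 : ∀ y, (h y ^ (1 / q)) ^ q = h y := fun y => by
    rw [← ENNReal.rpow_mul, one_div_mul_cancel hpq.symm.ne_zero, ENNReal.rpow_one]
  have e3 : ∀ y, (h y ^ (1 / p) * v y) ^ p = h y * v y ^ p := fun y => by
    rw [ENNReal.mul_rpow_of_nonneg _ _ hpq.nonneg, ← ENNReal.rpow_mul,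
      one_div_mul_cancel hpq.ne_zero, ENNReal.rpow_one]
  simp only [e1, e2, e3] at h1
  calc (∫⁻ y, h y * v y ∂μ) ^ p
      ≤ ((∫⁻ y, h y ∂μ) ^ (1 / q) * (∫⁻ y, h y * v y ^ p ∂μ) ^ (1 / p)) ^ p := by
        gcongr
    _ = _ := by
      rw [ENNReal.mul_rpow_of_nonneg _ _ hpq.nonneg, ← ENNReal.rpow_mul, ← ENNReal.rpow_mul,
        one_div_mul_cancel hpq.ne_zero, ENNReal.rpow_one]
      congr 2
      rw [one_div, inv_mul_eq_div, hpq.div_conj_eq_sub_one]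

end Young

section Convolution

variable {G : Type*} [AddCommGroup G] [MeasurableSpace G] [MeasurableAdd₂ G] [MeasurableNeg G]
  {μ : Measure G} [μ.IsAddLeftInvariant] [μ.IsNegInvariant]

/-- Young's inequality for the convolution of an integrable with a `p`-integrable function. -/
theorem eLpNorm'_lintegral_mul_le [SFinite μ] {p : ℝ} (hp : 1 ≤ p) {h v : G → ℝ≥0∞}
    (hh : Measurable h)
    (hv : Measurable v) :
    eLpNorm' (fun x => ∫⁻ y, h (x - y) * v y ∂μ) p μ ≤ (∫⁻ y, h y ∂μ) * eLpNorm' v p μ := by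
  have hp0 : 0 < p := by linarith
  simp only [eLpNorm', enorm_eq_self]
  have hsub : Measurable fun z : G × G => z.1 - z.2 := by
    simp only [sub_eq_add_neg]
    exact measurable_fst.add measurable_snd.neg
  have h1 : ∀ x, ∫⁻ y, h (x - y) ∂μ = ∫⁻ y, h y ∂μ := fun x =>
    lintegral_sub_left_eq_self h x
  have h2 : ∀ y, ∫⁻ x, h (x - y) ∂μ = ∫⁻ y, h y ∂μ := fun y => by
    simp only [sub_eq_add_neg]
    exact lintegral_add_right_eq_self h (-y)
  have h3 : ∫⁻ x, (∫⁻ y, h (x - y) * v y ∂μ) ^ p ∂μ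
      ≤ (∫⁻ y, h y ∂μ) ^ p * ∫⁻ y, v y ^ p ∂μ := by
    calc ∫⁻ x, (∫⁻ y, h (x - y) * v y ∂μ) ^ p ∂μ
        ≤ ∫⁻ x, (∫⁻ y, h y ∂μ) ^ (p - 1) * ∫⁻ y, h (x - y) * v y ^ p ∂μ ∂μ := by
          refine lintegral_mono fun x => ?_
          refine (lintegral_mul_rpow_le hp (hh.comp (hsub.comp measurable_prodMk_left)).aemeasurable
            hv.aemeasurable).trans_eq ?_
          rw [← h1 x]
          rfl
      _ = (∫⁻ y, h y ∂μ) ^ (p - 1) * ∫⁻ y, ∫⁻ x, h (x - y) * v y ^ p ∂μ ∂μ := by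
          rw [lintegral_const_mul]
          · congr 1
            exact lintegral_lintegral_swap
              ((hh.comp hsub).mul ((hv.comp measurable_snd).pow_const p)).aemeasurable
          · exact Measurable.lintegral_prod_right'
              ((hh.comp hsub).mul ((hv.comp measurable_snd).pow_const p))
      _ = (∫⁻ y, h y ∂μ) ^ (p - 1) * ((∫⁻ y, h y ∂μ) * ∫⁻ y, v y ^ p ∂μ) := by
          congr 1
          rw [← lintegral_const_mul _ (hv.pow_const p)]
          refine lintegral_congr fun y => ?_
          have h4 : Measurable fun x => h (x - y) := hh.comp (hsub.comp measurable_prodMk_right)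
          rw [lintegral_mul_const _ h4, h2 y]
      _ = _ := by
          rw [← mul_assoc]
          congr 1
          nth_rewrite 2 [← ENNReal.rpow_one (∫⁻ y, h y ∂μ)]
          rw [← ENNReal.rpow_add_of_nonneg _ _ (by linarith) zero_le_one, sub_add_cancel]
  calc _ ≤ ((∫⁻ y, h y ∂μ) ^ p * ∫⁻ y, v y ^ p ∂μ) ^ (1 / p) := by gcongr
    _ = _ := by
      rw [ENNReal.mul_rpow_of_nonneg _ _ (by positivity), ← ENNReal.rpow_mul,
        mul_one_div_cancel hp0.ne', ENNReal.rpow_one]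

theorem lintegral_conv_le_eLpNorm' {p q : ℝ} (hpq : p.HolderConjugate q) {h v : G → ℝ≥0∞}
    (hh : Measurable h) (hv : Measurable v) (x : G) :
    ∫⁻ y, h (x - y) * v y ∂μ ≤ eLpNorm' h q μ * eLpNorm' v p μ := by
  simp only [eLpNorm', enorm_eq_self]
  have hsub : Measurable fun y : G => x - y := by
    simp only [sub_eq_add_neg]
    exact measurable_neg.const_add x
  refine (ENNReal.lintegral_mul_le_Lp_mul_Lq μ hpq.symm (hh.comp hsub).aemeasurable
    hv.aemeasurable).trans_eq ?_
  congr 2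
  exact lintegral_sub_left_eq_self (fun y => h y ^ q) x

end Convolution

/-! ### Dilations of the kernels -/

theorem lintegral_comp_zpow_smul (j : ℤ) {F : Plane → ℝ≥0∞} (hF : Measurable F) :
    ∫⁻ x, F ((2 : ℝ) ^ j • x) = (2 : ℝ≥0∞) ^ (-((j : ℝ) * 2)) * ∫⁻ x, F x := by
  have h0 : (2 : ℝ) ^ j ≠ 0 := by positivity
  have h1 := Measure.map_addHaar_smul (volume : Measure Plane) h0
  have h2 : ∫⁻ x, F ((2 : ℝ) ^ j • x) = ∫⁻ x, F x ∂(Measure.map ((2 : ℝ) ^ j • ·) volume) :=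
    (lintegral_map hF (measurable_const_smul _)).symm
  rw [h2, h1, lintegral_smul_measure, smul_eq_mul]
  congr 1
  have h3 : |((2 : ℝ) ^ j) ^ Module.finrank ℝ Plane|⁻¹ = (2 : ℝ) ^ (-((j : ℝ) * 2)) := by
    rw [finrank_euclideanSpace_fin, abs_of_pos (by positivity), Real.rpow_neg (by norm_num),
      Real.rpow_mul (by norm_num), Real.rpow_intCast]
    norm_num
  rw [abs_inv, h3, ← ENNReal.ofReal_rpow_of_pos (by norm_num), ENNReal.ofReal_ofNat]

theorem enorm_two_zpow (j : ℤ) : ‖(2 : ℝ) ^ j‖ₑ = (2 : ℝ≥0∞) ^ (j : ℝ) := by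
  rw [← Real.rpow_intCast, Real.enorm_eq_ofReal (by positivity),
    ← ENNReal.ofReal_rpow_of_pos (by norm_num), ENNReal.ofReal_ofNat]

theorem two_rpow_mul_two_rpow (a b : ℝ) :
    (2 : ℝ≥0∞) ^ a * (2 : ℝ≥0∞) ^ b = (2 : ℝ≥0∞) ^ (a + b) :=
  (ENNReal.rpow_add a b two_ne_zero ENNReal.ofNat_ne_top).symm

theorem two_rpow_ne_top (a : ℝ) : (2 : ℝ≥0∞) ^ a ≠ ⊤ :=
  ENNReal.rpow_ne_top_of_ne_zero two_ne_zero ENNReal.ofNat_ne_top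

/-- The modulus of the `L¹`-normalized dilation `2^{2j} A(2^j x)`. -/
def dilation (A : Plane → ℂ) (j : ℤ) (x : Plane) : ℝ≥0∞ :=
  (2 : ℝ≥0∞) ^ ((j : ℝ) * 2) * ‖A ((2 : ℝ) ^ j • x)‖ₑ

theorem measurable_dilation (A : 𝓢(Plane, ℂ)) (j : ℤ) : Measurable (dilation A j) :=
  ((A.continuous.comp (continuous_const_smul _)).measurable.enorm).const_mul _

theorem lintegral_dilation (A : 𝓢(Plane, ℂ)) (j : ℤ) :
    ∫⁻ x, dilation A j x = ∫⁻ x, ‖A x‖ₑ := by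
  have hA : Measurable fun x => ‖A x‖ₑ := A.continuous.measurable.enorm
  have h := lintegral_comp_zpow_smul j hA
  beta_reduce at h
  simp only [dilation]
  rw [lintegral_const_mul' _ _ (two_rpow_ne_top _), h, ← mul_assoc, two_rpow_mul_two_rpow,
    add_neg_cancel,
    ENNReal.rpow_zero, one_mul]

theorem eLpNorm'_dilation {p q : ℝ} (hpq : p.HolderConjugate q) (A : 𝓢(Plane, ℂ)) (j : ℤ) :
    eLpNorm' (dilation A j) q volume = (2 : ℝ≥0∞) ^ ((j : ℝ) * (2 / p)) * eLpNorm' A q volume := by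
  have hA : Measurable fun x => ‖A x‖ₑ ^ q := A.continuous.measurable.enorm.pow_const q
  have hq := hpq.symm.pos
  have h := lintegral_comp_zpow_smul j hA
  beta_reduce at h
  simp only [eLpNorm', enorm_eq_self, dilation, ENNReal.mul_rpow_of_nonneg _ _ hq.le]
  rw [lintegral_const_mul' _ _ (ENNReal.rpow_ne_top_of_nonneg hq.le (two_rpow_ne_top _)),
    h, ← mul_assoc, ← ENNReal.rpow_mul, two_rpow_mul_two_rpow,
    ENNReal.mul_rpow_of_nonneg _ _ (by positivity), ← ENNReal.rpow_mul]
  congr 2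
  -- The normalization contributes $2^{2j}$ and the change of variables $2^{-2j/q}$; together they
  -- give $2^{2j/p}$.
  have h1 : 1 / q = 1 - 1 / p := by
    rw [one_div, one_div, ← hpq.inv_add_inv_eq_one]; ring
  have h2 : (j : ℝ) * 2 * q * (1 / q) = j * 2 := by field_simp
  rw [add_mul, h2, h1]
  ring

/-- Convolution with a dilation of a Schwartz function: `L^p` and Bernstein bounds. -/
theorem exists_dilation_conv_le {p : ℝ} (hp : 1 < p) (A : 𝓢(Plane, ℂ)) :
    ∃ C : ℝ≥0, ∀ (j : ℤ) (v : Plane → ℝ≥0∞), Measurable v →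
      eLpNorm' (fun x => ∫⁻ y, dilation A j (x - y) * v y) p volume ≤ C * eLpNorm' v p volume ∧
      ∀ x, ∫⁻ y, dilation A j (x - y) * v y
        ≤ (2 : ℝ≥0∞) ^ ((j : ℝ) * (2 / p)) * (C * eLpNorm' v p volume) := by
  have hpq := Real.HolderConjugate.conjExponent hp
  set q := p.conjExponent
  have h1 : ∫⁻ x, ‖A x‖ₑ ≠ ⊤ := A.integrable.2.ne
  have h2 : eLpNorm' A q volume ≠ ⊤ := by
    have h3 := (A.eLpNorm_lt_top (ENNReal.ofReal q) volume).ne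
    rwa [eLpNorm_eq_eLpNorm' (by simpa using hpq.symm.pos) ENNReal.ofReal_ne_top,
      ENNReal.toReal_ofReal hpq.symm.nonneg] at h3
  refine ⟨(∫⁻ x, ‖A x‖ₑ).toNNReal + (eLpNorm' A q volume).toNNReal, fun j v hv => ⟨?_, fun x => ?_⟩⟩
  · refine (eLpNorm'_lintegral_mul_le hp.le (measurable_dilation A j) hv).trans ?_
    rw [lintegral_dilation, ENNReal.coe_add, ENNReal.coe_toNNReal h1]
    gcongr
    exact le_self_add
  · refine (lintegral_conv_le_eLpNorm' hpq (measurable_dilation A j) hv x).trans ?_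
    rw [eLpNorm'_dilation hpq, ENNReal.coe_add, ENNReal.coe_toNNReal h2, mul_assoc]
    gcongr
    exact le_add_self

/-- For $|y|\le1$ the $L^1$ norm is controlled by Schwartz seminorms of the difference; for $|y|>1$
the triangle inequality suffices. -/
theorem exists_lintegral_sub_le (A : 𝓢(Plane, ℂ)) :
    ∃ C : ℝ≥0, ∀ y : Plane, ∫⁻ x, ‖A (x - y) - A x‖ₑ ≤ C * ‖y‖ₑ := by
  obtain ⟨k, C, hC⟩ := SchwartzMap.eLpNorm_le_seminorm ℂ (E := Plane) ℂ 1 volume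
  choose D hD0 hD using fun i : ℕ × ℕ => seminorm_compSubConst_sub_le A i.1 i.2
  have h1 : ∫⁻ x, ‖A x‖ₑ ≠ ⊤ := A.integrable.2.ne
  set S : ℝ := ∑ i ∈ Finset.Iic (k, 0), D i
  have hS : 0 ≤ S := Finset.sum_nonneg fun i _ => hD0 i
  refine ⟨2 * (∫⁻ x, ‖A x‖ₑ).toNNReal + C * S.toNNReal, fun y => ?_⟩
  rw [ENNReal.coe_add, ENNReal.coe_mul, ENNReal.coe_mul, ENNReal.coe_toNNReal h1, add_mul]
  rcases le_or_gt ‖y‖ 1 with hy | hy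
  · refine le_trans ?_ le_add_self
    have h2 := hC (compSubConstCLM ℂ y A - A)
    rw [eLpNorm_one_eq_lintegral_enorm] at h2
    refine h2.trans ?_
    rw [mul_assoc]
    gcongr
    rw [← ofReal_norm]
    change _ ≤ ENNReal.ofReal S * _
    rw [← ENNReal.ofReal_mul hS]
    refine ENNReal.ofReal_le_ofReal (Seminorm.finset_sup_apply_le (by positivity) fun i hi => ?_)
    refine (hD i y hy).trans ?_
    gcongr
    exact Finset.single_le_sum (f := D) (fun i _ => hD0 i) hi
  · refine le_trans ?_ le_self_add
    have h2 : (1 : ℝ≥0∞) ≤ ‖y‖ₑ := by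
      rw [← ofReal_norm, ENNReal.one_le_ofReal]
      exact hy.le
    have h3 : ∫⁻ x, ‖A (x - y)‖ₑ = ∫⁻ x, ‖A x‖ₑ :=
      lintegral_sub_right_eq_self (fun x => ‖A x‖ₑ) y
    calc ∫⁻ x, ‖A (x - y) - A x‖ₑ ≤ ∫⁻ x, (‖A (x - y)‖ₑ + ‖A x‖ₑ) :=
          lintegral_mono fun x => enorm_sub_le
      _ = 2 * ∫⁻ x, ‖A x‖ₑ := by
          rw [lintegral_add_right _ A.continuous.measurable.enorm, h3, two_mul]
      _ ≤ 2 * (∫⁻ x, ‖A x‖ₑ) * ‖y‖ₑ := le_mul_of_one_le_right' h2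
      _ = _ := by norm_num

namespace Bump

variable (ψ : Bump)

/-- All kernels are dilates of fixed profiles, which makes every later constant uniform in the
frequency index. -/
theorem kernel_add (j i : ℤ) (x : Plane) :
    ψ.kernel (j + i) x = ((2 : ℝ) ^ j) ^ 2 • ψ.kernel i ((2 : ℝ) ^ j • x) := by
  have hpos : (0 : ℝ) < 2 ^ j := by positivity
  rw [kernel, kernel, SchwartzMap.fourierInv_coe, SchwartzMap.fourierInv_coe, Real.fourierInv_eq,
    Real.fourierInv_eq]
  have h1 := Measure.integral_comp_inv_smul_of_nonneg (volume : Measure Plane)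
    (fun v => Real.fourierChar (inner ℝ v ((2 : ℝ) ^ j • x)) • (ψ.phiS i v : ℂ)) hpos.le
  rw [finrank_euclideanSpace_fin] at h1
  rw [← h1]
  refine integral_congr_ae (Eventually.of_forall fun v => ?_)
  have h2 : inner ℝ (((2 : ℝ) ^ j)⁻¹ • v) ((2 : ℝ) ^ j • x) = inner ℝ v x := by
    rw [inner_smul_left, inner_smul_right, ← mul_assoc]
    simp [hpos.ne']
  have h3 : ψ.phi (j + i) v = ψ.phi i (((2 : ℝ) ^ j)⁻¹ • v) := by
    rw [phi, phi, smul_smul, neg_add, zpow_add₀ two_ne_zero, zpow_neg, zpow_neg, mul_comm]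
  simp only [h2, phiS_apply, h3]

theorem enorm_kernel (j : ℤ) (x : Plane) :
    ‖ψ.kernel j x‖ₑ = dilation (ψ.kernel 0) j x := by
  have h := ψ.kernel_add j 0 x
  rw [add_zero] at h
  rw [h, enorm_smul, enorm_pow, enorm_two_zpow, dilation, ← ENNReal.rpow_natCast,
    ← ENNReal.rpow_mul]
  rfl

theorem fatKernel_eq (j : ℤ) (x : Plane) :
    ψ.fatKernel j x = ((2 : ℝ) ^ j) ^ 2 • ψ.fatKernel 0 ((2 : ℝ) ^ j • x) := by
  have h0 := ψ.kernel_add j 0 x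
  have h1 := ψ.kernel_add j 1 x
  have h2 := ψ.kernel_add j (-1) x
  rw [add_zero] at h0
  simp only [fatKernel, add_apply, smul_add, zero_add, zero_sub]
  rw [← h0, ← h1, ← h2]
  rfl

theorem enorm_fatKernel (j : ℤ) (x : Plane) :
    ‖ψ.fatKernel j x‖ₑ = dilation (ψ.fatKernel 0) j x := by
  rw [fatKernel_eq, enorm_smul, enorm_pow, enorm_two_zpow, dilation, ← ENNReal.rpow_natCast,
    ← ENNReal.rpow_mul]
  rfl

end Bump

/-! ### Estimates for the terms of the commutator -/

/-- An `L^p` bound by `w` together with the Bernstein bound at frequency `2^j`. -/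
def BernsteinBound (p : ℝ) (j : ℤ) (T : Plane → ℂ) (w : ℝ≥0∞) : Prop :=
  eLpNorm' T p volume ≤ w ∧ ∀ x, ‖T x‖ₑ ≤ (2 : ℝ≥0∞) ^ ((j : ℝ) * (2 / p)) * w

namespace BernsteinBound

variable {p : ℝ} {j : ℤ} {T U : Plane → ℂ} {v w : ℝ≥0∞}

theorem mono (h : BernsteinBound p j T v) (hvw : v ≤ w) : BernsteinBound p j T w :=
  ⟨h.1.trans hvw, fun x => (h.2 x).trans (by gcongr)⟩

theorem of_eq_zero (hp : 0 < p) (h : ∀ x, T x = 0) : BernsteinBound p j T w := by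
  obtain rfl : T = 0 := funext h
  exact ⟨by simp [eLpNorm'_zero hp], by simp⟩

theorem sub (hp : 1 ≤ p) (hT : BernsteinBound p j T v) (hU : BernsteinBound p j U w)
    (hTm : AEStronglyMeasurable T) (hUm : AEStronglyMeasurable U) :
    BernsteinBound p j (fun x => T x - U x) (v + w) := by
  refine ⟨?_, fun x => ?_⟩
  · have h1 := eLpNorm'_add_le hTm hUm.neg hp
    have h2 : eLpNorm' (-U) p volume = eLpNorm' U p volume := eLpNorm'_neg ..
    rw [h2, ← sub_eq_add_neg] at h1
    exact h1.trans (add_le_add hT.1 hU.1)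
  · rw [mul_add]
    exact enorm_sub_le.trans (add_le_add (hT.2 x) (hU.2 x))

/-- In the applications `u` is the block measured in $L^p$, while `m` collects the sup or Lipschitz
bound of the other factor. -/
theorem exists_of_conv (hp : 1 < p) (A : 𝓢(Plane, ℂ)) :
    ∃ C : ℝ≥0, ∀ (j : ℤ) (u T : Plane → ℂ) (m : ℝ≥0∞), Continuous u → m ≠ ⊤ →
      (∀ x, ‖T x‖ₑ ≤ m * ∫⁻ y, dilation A j (x - y) * ‖u y‖ₑ) →
      BernsteinBound p j T (C * m * eLpNorm' u p volume) := by
  obtain ⟨C, hC⟩ := exists_dilation_conv_le hp A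
  refine ⟨C, fun j u T m hu hm hT => ?_⟩
  obtain ⟨h1, h2⟩ := hC j (fun y => ‖u y‖ₑ) hu.measurable.enorm
  have hp0 : 0 < p := by linarith
  have h3 : eLpNorm' (fun y => ‖u y‖ₑ) p volume = eLpNorm' u p volume := by
    simp only [eLpNorm', enorm_eq_self]
  rw [h3] at h1 h2
  refine ⟨?_, fun x => (hT x).trans ?_⟩
  · calc eLpNorm' T p volume
        ≤ (∫⁻ x, (m * ∫⁻ y, dilation A j (x - y) * ‖u y‖ₑ) ^ p) ^ (1 / p) := by
          rw [eLpNorm']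
          gcongr with x
          exact hT x
      _ = m * eLpNorm' (fun x => ∫⁻ y, dilation A j (x - y) * ‖u y‖ₑ) p volume := by
          simp only [eLpNorm', enorm_eq_self, ENNReal.mul_rpow_of_nonneg _ _ hp0.le]
          rw [lintegral_const_mul' _ _ (ENNReal.rpow_ne_top_of_nonneg hp0.le hm),
            ENNReal.mul_rpow_of_nonneg _ _ (by positivity), ← ENNReal.rpow_mul,
            mul_one_div_cancel hp0.ne', ENNReal.rpow_one]
      _ ≤ m * (C * eLpNorm' u p volume) := by gcongr
      _ = _ := by ring
  · calc _ ≤ m * ((2 : ℝ≥0∞) ^ ((j : ℝ) * (2 / p)) * (C * eLpNorm' u p volume)) := by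
          gcongr
          exact h2 x
      _ = _ := by ring

end BernsteinBound

namespace Bump

variable (ψ : Bump)

theorem stronglyMeasurable_blockFun (j : ℤ) {u : Plane → ℂ} (hu : Continuous u) :
    StronglyMeasurable (ψ.blockFun j u) := by
  have h : Continuous (Function.uncurry fun x y => ψ.kernel j (x - y) * u y) :=
    ((ψ.kernel j).continuous.comp (continuous_fst.sub continuous_snd)).mul
      (hu.comp continuous_snd)
  exact h.stronglyMeasurable.integral_prod_right

theorem enorm_blockFun_le (j : ℤ) (u : Plane → ℂ) (x : Plane) :
    ‖ψ.blockFun j u x‖ₑ ≤ ∫⁻ y, dilation (ψ.kernel 0) j (x - y) * ‖u y‖ₑ := by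
  refine (enorm_integral_le_lintegral_enorm _).trans_eq (lintegral_congr fun y => ?_)
  rw [enorm_mul, enorm_kernel]

theorem exists_enorm_block_le {p : ℝ} (hp : 1 < p) :
    ∃ C : ℝ≥0, ∀ (k : ℤ) (f : ZDual) (x : Plane), ‖ψ.block k f x‖ₑ
      ≤ C * ((2 : ℝ≥0∞) ^ ((k : ℝ) * (2 / p)) * eLpNorm' (ψ.block k f) p volume) := by
  obtain ⟨C, hC⟩ := BernsteinBound.exists_of_conv hp (ψ.fatKernel 0)
  refine ⟨C, fun k f x => ?_⟩
  have h := (hC k (ψ.block k f) (ψ.block k f) 1 (ψ.continuous_block k f) ENNReal.one_ne_top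
    fun x => ?_).2 x
  · refine h.trans_eq ?_
    ring
  · rw [one_mul]
    conv_lhs => rw [block_eq_integral]
    refine (enorm_integral_le_lintegral_enorm _).trans_eq (lintegral_congr fun y => ?_)
    rw [enorm_mul, enorm_fatKernel]

theorem exists_lintegral_fatKernel_sub_le :
    ∃ C : ℝ≥0, ∀ (k : ℤ) (h : Plane),
      ∫⁻ a, ‖ψ.fatKernel k (a - h) - ψ.fatKernel k a‖ₑ ≤ C * ((2 : ℝ≥0∞) ^ (k : ℝ) * ‖h‖ₑ) := by
  obtain ⟨C, hC⟩ := exists_lintegral_sub_le (ψ.fatKernel 0)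
  refine ⟨C, fun k h => ?_⟩
  have h1 := hC ((2 : ℝ) ^ k • h)
  rw [enorm_smul, enorm_two_zpow] at h1
  refine le_trans (le_of_eq ?_) h1
  have hm : Measurable fun a => ‖ψ.fatKernel 0 (a - (2 : ℝ) ^ k • h) - ψ.fatKernel 0 a‖ₑ :=
    (((ψ.fatKernel 0).continuous.comp (by fun_prop)).sub
      (ψ.fatKernel 0).continuous).measurable.enorm
  have h2 := lintegral_comp_zpow_smul k hm
  beta_reduce at h2
  have h3 : ∀ a, ‖ψ.fatKernel k (a - h) - ψ.fatKernel k a‖ₑ = (2 : ℝ≥0∞) ^ ((k : ℝ) * 2) *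
      ‖ψ.fatKernel 0 ((2 : ℝ) ^ k • a - (2 : ℝ) ^ k • h) - ψ.fatKernel 0 ((2 : ℝ) ^ k • a)‖ₑ := by
    intro a
    rw [fatKernel_eq, ψ.fatKernel_eq k a, ← smul_sub, ← smul_sub, enorm_smul, enorm_pow,
      enorm_two_zpow, ← ENNReal.rpow_natCast, ← ENNReal.rpow_mul]
    norm_num
  simp only [h3]
  rw [lintegral_const_mul' _ _ (two_rpow_ne_top _), h2, ← mul_assoc, two_rpow_mul_two_rpow,
    add_neg_cancel, ENNReal.rpow_zero, one_mul]

theorem exists_norm_le_of_enorm_le {u : Plane → ℂ} {M : ℝ≥0∞} (hM : M ≠ ⊤)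
    (h : ∀ x, ‖u x‖ₑ ≤ M) (x : Plane) : ‖u x‖ ≤ M.toReal := by
  have := ENNReal.toReal_mono hM (h x)
  rwa [toReal_enorm] at this

/-- Bernstein's gradient bound in difference form: the reproducing formula moves the increment onto
the kernel, whose $L^1$ modulus of continuity is $\lesssim 2^k|h|$. -/
theorem exists_enorm_block_sub_le :
    ∃ C : ℝ≥0, ∀ (k : ℤ) (f : ZDual) (M : ℝ≥0∞), M ≠ ⊤ → (∀ x, ‖ψ.block k f x‖ₑ ≤ M) →
      ∀ x y, ‖ψ.block k f x - ψ.block k f y‖ₑ ≤ C * (2 : ℝ≥0∞) ^ (k : ℝ) * M * ‖x - y‖ₑ := by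
  obtain ⟨C, hC⟩ := ψ.exists_lintegral_fatKernel_sub_le
  refine ⟨C, fun k f M hMt hM x y => ?_⟩
  have hi : ∀ x, Integrable fun z => ψ.fatKernel k (x - z) * ψ.block k f z := fun x =>
    ((ψ.fatKernel k).integrable.comp_sub_left x).mul_bdd
      (ψ.continuous_block k f).aestronglyMeasurable
      (Eventually.of_forall (exists_norm_le_of_enorm_le hMt hM))
  rw [ψ.block_eq_integral k f x, ψ.block_eq_integral k f y, ← integral_sub (hi x) (hi y)]
  refine (enorm_integral_le_lintegral_enorm _).trans ?_
  have h1 : ∫⁻ z, ‖ψ.fatKernel k (x - z) - ψ.fatKernel k (y - z)‖ₑ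
      = ∫⁻ a, ‖ψ.fatKernel k (a - (x - y)) - ψ.fatKernel k a‖ₑ := by
    rw [← lintegral_sub_left_eq_self _ x]
    refine lintegral_congr fun z => ?_
    rw [← enorm_neg, neg_sub, sub_sub_cancel]
    congr 3
    abel
  calc ∫⁻ z, ‖ψ.fatKernel k (x - z) * ψ.block k f z - ψ.fatKernel k (y - z) * ψ.block k f z‖ₑ
      ≤ ∫⁻ z, ‖ψ.fatKernel k (x - z) - ψ.fatKernel k (y - z)‖ₑ * M := by
        refine lintegral_mono fun z => ?_
        beta_reduce
        rw [← sub_mul, enorm_mul]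
        gcongr
        exact hM z
    _ = (∫⁻ z, ‖ψ.fatKernel k (x - z) - ψ.fatKernel k (y - z)‖ₑ) * M :=
        lintegral_mul_const' _ _ hMt
    _ ≤ C * ((2 : ℝ≥0∞) ^ (k : ℝ) * ‖x - y‖ₑ) * M := by
        rw [h1]
        gcongr
        exact hC k _
    _ = _ := by ring

/-- A Schwartz function whose modulus dominates `|x| |h₀(x)|`. -/
def weightedKernel : 𝓢(Plane, ℂ) :=
  smulLeftCLM ℂ (fun x : Plane => ((1 + ‖x‖ ^ 2 : ℝ) : ℂ)) (ψ.kernel 0)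

theorem enorm_mul_enorm_kernel_le (x : Plane) :
    ‖ψ.kernel 0 x‖ₑ * ‖x‖ₑ ≤ ‖ψ.weightedKernel x‖ₑ := by
  have ht : (fun x : Plane => ((1 + ‖x‖ ^ 2 : ℝ) : ℂ)).HasTemperateGrowth := by
    have h0 : (fun x : Plane => 1 + ‖x‖ ^ 2).HasTemperateGrowth := by fun_prop
    exact Complex.ofRealCLM.hasTemperateGrowth.comp h0
  rw [weightedKernel, smulLeftCLM_apply_apply ht, enorm_smul, mul_comm]
  gcongr
  rw [← ofReal_norm, ← ofReal_norm]
  refine ENNReal.ofReal_le_ofReal ?_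
  rw [Complex.norm_real, Real.norm_of_nonneg (by positivity)]
  nlinarith [sq_nonneg (‖x‖ - 1)]

theorem dilation_kernel_mul_enorm_le (j : ℤ) (x : Plane) :
    dilation (ψ.kernel 0) j x * ‖x‖ₑ
      ≤ (2 : ℝ≥0∞) ^ (-(j : ℝ)) * dilation ψ.weightedKernel j x := by
  have h1 := ψ.enorm_mul_enorm_kernel_le ((2 : ℝ) ^ j • x)
  have h2 : ‖x‖ₑ = (2 : ℝ≥0∞) ^ (-(j : ℝ)) * ‖(2 : ℝ) ^ j • x‖ₑ := by
    rw [enorm_smul, enorm_two_zpow, ← mul_assoc, two_rpow_mul_two_rpow, neg_add_cancel,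
      ENNReal.rpow_zero, one_mul]
  rw [h2, dilation, dilation]
  calc _ = (2 : ℝ≥0∞) ^ (-(j : ℝ)) * ((2 : ℝ≥0∞) ^ ((j : ℝ) * 2) *
        (‖ψ.kernel 0 ((2 : ℝ) ^ j • x)‖ₑ * ‖(2 : ℝ) ^ j • x‖ₑ)) := by ring
    _ ≤ _ := by gcongr

/-- The commutator with a Lipschitz function. -/
theorem enorm_commFun_le (j : ℤ) {u v : Plane → ℂ} (hu : Continuous u) (hv : Continuous v)
    {M N : ℝ} (hM : ∀ x, ‖u x‖ ≤ M) (hN : ∀ x, ‖v x‖ ≤ N) {K : ℝ≥0∞} (hK : K ≠ ⊤)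
    (hl : ∀ x y, ‖u x - u y‖ₑ ≤ K * ‖x - y‖ₑ) (x : Plane) :
    ‖ψ.commFun j u v x‖ₑ
      ≤ K * (2 : ℝ≥0∞) ^ (-(j : ℝ)) * ∫⁻ y, dilation ψ.weightedKernel j (x - y) * ‖v y‖ₑ := by
  have hN0 : 0 ≤ N := (norm_nonneg _).trans (hN 0)
  have h1 := ψ.integrable_kernel_mul j x (u := fun y => u y * v y) (hu.mul hv)
    (M := M * N) fun x => by
    rw [norm_mul]
    exact mul_le_mul (hM x) (hN x) (norm_nonneg _) ((norm_nonneg _).trans (hM x))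
  have h2 := (ψ.integrable_kernel_mul j x hv hN).const_mul (u x)
  rw [commFun, blockFun, blockFun, ← integral_const_mul, ← integral_sub h1 h2,
    ← lintegral_const_mul' _ _ (ENNReal.mul_ne_top hK (two_rpow_ne_top _))]
  refine (enorm_integral_le_lintegral_enorm _).trans (lintegral_mono fun y => ?_)
  -- The gain of the commutator: $u(y)-u(x)$ supplies a factor $|x-y|$, which the kernel absorbs at
  -- the price of $2^{-j}$.
  have h3 : ψ.kernel j (x - y) * (u y * v y) - u x * (ψ.kernel j (x - y) * v y)
      = ψ.kernel j (x - y) * (u y - u x) * v y := by ring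
  beta_reduce
  rw [h3, enorm_mul, enorm_mul, enorm_kernel]
  calc _ ≤ dilation (ψ.kernel 0) j (x - y) * (K * ‖x - y‖ₑ) * ‖v y‖ₑ := by
        gcongr
        rw [← enorm_neg (x - y), neg_sub]
        exact hl y x
    _ = K * (dilation (ψ.kernel 0) j (x - y) * ‖x - y‖ₑ) * ‖v y‖ₑ := by ring
    _ ≤ K * ((2 : ℝ≥0∞) ^ (-(j : ℝ)) * dilation ψ.weightedKernel j (x - y)) * ‖v y‖ₑ := by
        gcongr ?_ * _
        gcongr K * ?_
        exact ψ.dilation_kernel_mul_enorm_le j _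
    _ = _ := by ring

end Bump

/-! ### Case analysis in $(k,l)$ for a single commutator term. -/

namespace Bump

variable (ψ : Bump)

/-- The common majorant of `‖[Δⱼ, Δₖ f] Δₗ g‖_{L^p}`, up to a constant factor, where `a` and `b`
are the `L^p` norms of `Δₖ f` and `Δₗ g`. -/
def termMajorant (p : ℝ) (a b : ℤ → ℝ≥0∞) (j k l : ℤ) : ℝ≥0∞ :=
  (if |l - j| ≤ 3 then min 1 ((2 : ℝ≥0∞) ^ ((k - j : ℤ) : ℝ))
    * ((2 : ℝ≥0∞) ^ ((k : ℝ) * (2 / p)) * a k) * b l else 0)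
  + (if j ≤ k + 8 ∧ l ≤ k + 5 then a k * ((2 : ℝ≥0∞) ^ ((l : ℝ) * (2 / p)) * b l) else 0)

theorem aestronglyMeasurable_block_mul_blockFun (j k l : ℤ) (f g : ZDual) :
    AEStronglyMeasurable (fun x => ψ.block k f x * ψ.blockFun j (ψ.block l g) x) :=
  (ψ.continuous_block k f).aestronglyMeasurable.mul
    (ψ.stronglyMeasurable_blockFun j (ψ.continuous_block l g)).aestronglyMeasurable

theorem aestronglyMeasurable_blockFun_mul (j k l : ℤ) (f g : ZDual) :
    AEStronglyMeasurable (ψ.blockFun j fun y => ψ.block k f y * ψ.block l g y) :=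
  (ψ.stronglyMeasurable_blockFun j
    ((ψ.continuous_block k f).mul (ψ.continuous_block l g))).aestronglyMeasurable

theorem aestronglyMeasurable_commTerm (j : ℤ) (f g : ZDual) (kl : ℤ × ℤ) :
    AEStronglyMeasurable (ψ.commTerm j f g kl) :=
  (ψ.aestronglyMeasurable_blockFun_mul j kl.1 kl.2 f g).sub
    (ψ.aestronglyMeasurable_block_mul_blockFun j kl.1 kl.2 f g)

theorem exists_commTerm_bound {p : ℝ} (hp : 1 < p) :
    ∃ C : ℝ≥0, ∀ f g : ZDual, (∀ k, eLpNorm' (ψ.block k f) p volume ≠ ⊤) →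
      (∀ l, eLpNorm' (ψ.block l g) p volume ≠ ⊤) → ∀ j k l : ℤ,
      BernsteinBound p j (ψ.commTerm j f g (k, l))
        (C * termMajorant p (fun k => eLpNorm' (ψ.block k f) p volume)
          (fun l => eLpNorm' (ψ.block l g) p volume) j k l) := by
  obtain ⟨B, hB⟩ := ψ.exists_enorm_block_le hp
  obtain ⟨L, hL⟩ := ψ.exists_enorm_block_sub_le
  obtain ⟨C₁, hC₁⟩ := BernsteinBound.exists_of_conv hp (ψ.kernel 0)
  obtain ⟨C₂, hC₂⟩ := BernsteinBound.exists_of_conv hp ψ.weightedKernel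
  have hp0 : 0 < p := by linarith
  refine ⟨C₂ * L * B + C₁ * B * 2 ^ 7, fun f g hf hg j k l => ?_⟩
  set a := fun k => eLpNorm' (ψ.block k f) p volume
  set b := fun l => eLpNorm' (ψ.block l g) p volume
  set M : ℝ≥0∞ := B * ((2 : ℝ≥0∞) ^ ((k : ℝ) * (2 / p)) * a k)
  set N : ℝ≥0∞ := B * ((2 : ℝ≥0∞) ^ ((l : ℝ) * (2 / p)) * b l)
  have hMt : M ≠ ⊤ := ENNReal.mul_ne_top ENNReal.coe_ne_top
    (ENNReal.mul_ne_top (two_rpow_ne_top _) (hf k))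
  have hNt : N ≠ ⊤ := ENNReal.mul_ne_top ENNReal.coe_ne_top
    (ENNReal.mul_ne_top (two_rpow_ne_top _) (hg l))
  have hM : ∀ x, ‖ψ.block k f x‖ₑ ≤ M := hB k f
  have hN : ∀ x, ‖ψ.block l g x‖ₑ ≤ N := hB l g
  have hM' := exists_norm_le_of_enorm_le hMt hM
  have hN' := exists_norm_le_of_enorm_le hNt hN
  have hfc := ψ.continuous_block k f
  have hgc := ψ.continuous_block l g
  rcases le_or_gt (k + 6) l with hkl | hkl
  · by_cases hjl : |l - j| ≤ 3
    -- Low-high interaction: here $k<j$, so the minimum in the majorant equals the commutator gain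
    -- $2^{k-j}$.
    · have h1 := hC₂ j (ψ.block l g) (ψ.commTerm j f g (k, l))
        (L * (2 : ℝ≥0∞) ^ (k : ℝ) * M * (2 : ℝ≥0∞) ^ (-(j : ℝ))) hgc
        (ENNReal.mul_ne_top (ENNReal.mul_ne_top (ENNReal.mul_ne_top ENNReal.coe_ne_top
          (two_rpow_ne_top _)) hMt) (two_rpow_ne_top _))
        (ψ.enorm_commFun_le j hfc hgc hM' hN'
          (ENNReal.mul_ne_top (ENNReal.mul_ne_top ENNReal.coe_ne_top (two_rpow_ne_top _)) hMt)
          (hL k f M hMt hM))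
      refine h1.mono ?_
      have h2 : min 1 ((2 : ℝ≥0∞) ^ ((k - j : ℤ) : ℝ))
          = (2 : ℝ≥0∞) ^ (k : ℝ) * (2 : ℝ≥0∞) ^ (-(j : ℝ)) := by
        rw [two_rpow_mul_two_rpow, Int.cast_sub, ← sub_eq_add_neg]
        apply min_eq_right
        rw [← ENNReal.rpow_zero (x := 2)]
        refine ENNReal.rpow_le_rpow_of_exponent_le one_le_two ?_
        have : k - j ≤ 0 := by have := abs_le.1 hjl; omega
        exact_mod_cast this
      rw [termMajorant, if_pos hjl, h2, ENNReal.coe_add, add_mul, mul_add]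
      refine le_add_right (le_add_right (le_of_eq ?_))
      push_cast
      ring
    · refine BernsteinBound.of_eq_zero hp0 fun x => ?_
      have hjl' : 4 ≤ |j - l| := by rw [abs_sub_comm]; omega
      simp only [commTerm, commFun]
      rw [ψ.blockFun_block_mul_block_eq_zero_of_low_high hM' hN' hkl hjl',
        ψ.blockFun_block_eq_zero_of_far hN' (by omega), mul_zero, sub_zero]
  -- For $l\le k+5$ the two halves of the commutator are estimated separately, `hU` feeding the
  -- second summand of the majorant and `hV` the first.
  · have hU : BernsteinBound p j (ψ.blockFun j fun y => ψ.block k f y * ψ.block l g y)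
        (C₁ * B * (if j ≤ k + 8 ∧ l ≤ k + 5 then
          a k * ((2 : ℝ≥0∞) ^ ((l : ℝ) * (2 / p)) * b l) else 0)) := by
      by_cases hjk : j ≤ k + 8
      · rw [if_pos ⟨hjk, by omega⟩]
        refine (hC₁ j (ψ.block k f) _ N hfc hNt fun x => ?_).mono (le_of_eq (by ring))
        refine (ψ.enorm_blockFun_le j _ x).trans ?_
        rw [← lintegral_const_mul' _ _ hNt]
        refine lintegral_mono fun y => ?_
        beta_reduce
        rw [enorm_mul]
        calc _ ≤ dilation (ψ.kernel 0) j (x - y) * (‖ψ.block k f y‖ₑ * N) := by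
              gcongr
              exact hN y
          _ = _ := by ring
      · exact BernsteinBound.of_eq_zero hp0 fun x =>
          ψ.blockFun_block_mul_block_eq_zero_of_high hM' hN' (by omega) (by omega) x
    have hV : BernsteinBound p j (fun x => ψ.block k f x * ψ.blockFun j (ψ.block l g) x)
        (C₁ * B * 2 ^ 7 * (if |l - j| ≤ 3 then min 1 ((2 : ℝ≥0∞) ^ ((k - j : ℤ) : ℝ))
          * ((2 : ℝ≥0∞) ^ ((k : ℝ) * (2 / p)) * a k) * b l else 0)) := by
      by_cases hjl : |j - l| ≤ 2
      · rw [if_pos (by rw [abs_sub_comm]; omega)]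
        refine (hC₁ j (ψ.block l g) _ M hgc hMt fun x => ?_).mono ?_
        · rw [enorm_mul]
          gcongr
          · exact hM x
          · exact ψ.enorm_blockFun_le j _ x
        -- From $|j-l|\le2$ and $l\le k+5$ one gets $k-j\ge-7$, so inserting the low-high weight
        -- costs at most $2^7$ and both regimes share one summand.
        · have h2 : (1 : ℝ≥0∞) ≤ 2 ^ 7 * min 1 ((2 : ℝ≥0∞) ^ ((k - j : ℤ) : ℝ)) := by
            have h3 : (2 : ℝ≥0∞) ^ (-7 : ℝ) ≤ min 1 ((2 : ℝ≥0∞) ^ ((k - j : ℤ) : ℝ)) := by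
              refine le_min ?_ ?_
              · rw [← ENNReal.rpow_zero (x := 2)]
                exact ENNReal.rpow_le_rpow_of_exponent_le one_le_two (by norm_num)
              · refine ENNReal.rpow_le_rpow_of_exponent_le one_le_two ?_
                have : -7 ≤ k - j := by have := abs_le.1 hjl; omega
                exact_mod_cast this
            calc (1 : ℝ≥0∞) = 2 ^ 7 * (2 : ℝ≥0∞) ^ (-7 : ℝ) := by
                  rw [← ENNReal.rpow_natCast, two_rpow_mul_two_rpow]
                  norm_num
              _ ≤ _ := by gcongr
          calc C₁ * M * b l ≤ C₁ * M * b l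
                * (2 ^ 7 * min 1 ((2 : ℝ≥0∞) ^ ((k - j : ℤ) : ℝ))) := le_mul_of_one_le_right' h2
            _ = _ := by ring
      · refine BernsteinBound.of_eq_zero hp0 fun x => ?_
        rw [ψ.blockFun_block_eq_zero_of_far hN' (by omega), mul_zero]
    refine (hU.sub hp.le hV (ψ.aestronglyMeasurable_blockFun_mul j k l f g)
      (ψ.aestronglyMeasurable_block_mul_blockFun j k l f g)).mono ?_
    rw [termMajorant, add_comm, ENNReal.coe_add, add_mul]
    refine le_add_left ?_
    rw [mul_add]
    push_cast
    refine add_le_add (le_of_eq (by ring)) ?_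
    gcongr ?_ * _
    exact le_mul_of_one_le_right' (one_le_pow₀ one_le_two)

end Bump

/-! ### Sequence norms -/

/-- Brings Minkowski and the group version of Young's inequality to $\mathbb Z$ with counting
measure. -/
theorem ellNorm_eq_eLpNorm' {q : ℝ≥0∞} (hq : q ≠ ⊤) (a : ℤ → ℝ≥0∞) :
    ellNorm q a = eLpNorm' a q.toReal Measure.count := by
  rw [ellNorm, if_neg hq, eLpNorm', lintegral_count]
  rfl

theorem one_le_toReal {q : ℝ≥0∞} (hq : 1 ≤ q) (hqt : q ≠ ⊤) : 1 ≤ q.toReal := by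
  simpa using ENNReal.toReal_mono hqt hq

theorem le_ellNorm {q : ℝ≥0∞} (hq : 1 ≤ q) (a : ℤ → ℝ≥0∞) (k : ℤ) : a k ≤ ellNorm q a := by
  by_cases hqt : q = ⊤
  · rw [ellNorm, if_pos hqt]
    exact le_iSup a k
  · have h0 : 0 < q.toReal := zero_lt_one.trans_le (one_le_toReal hq hqt)
    rw [ellNorm, if_neg hqt, one_div, ENNReal.le_rpow_inv_iff h0]
    exact ENNReal.le_tsum k

theorem ellNorm_mono {q : ℝ≥0∞} {a b : ℤ → ℝ≥0∞} (h : ∀ k, a k ≤ b k) :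
    ellNorm q a ≤ ellNorm q b := by
  rw [ellNorm, ellNorm]
  split_ifs with hq
  · exact iSup_mono h
  · gcongr with k
    exact h k

theorem ellNorm_add_le {q : ℝ≥0∞} (hq : 1 ≤ q) (a b : ℤ → ℝ≥0∞) :
    ellNorm q (fun k => a k + b k) ≤ ellNorm q a + ellNorm q b := by
  by_cases hqt : q = ⊤
  · simp only [ellNorm, if_pos hqt]
    exact iSup_le fun k => add_le_add (le_iSup a k) (le_iSup b k)
  · rw [ellNorm_eq_eLpNorm' hqt, ellNorm_eq_eLpNorm' hqt, ellNorm_eq_eLpNorm' hqt]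
    exact eLpNorm'_add_le (Measurable.of_discrete (f := a)).aestronglyMeasurable
      (Measurable.of_discrete (f := b)).aestronglyMeasurable (one_le_toReal hq hqt)

theorem ellNorm_const_mul {q : ℝ≥0∞} (hq : 1 ≤ q) (c : ℝ≥0∞) (a : ℤ → ℝ≥0∞) :
    ellNorm q (fun k => c * a k) = c * ellNorm q a := by
  by_cases hqt : q = ⊤
  · simp only [ellNorm, if_pos hqt, ENNReal.mul_iSup]
  · have h0 : 0 < q.toReal := zero_lt_one.trans_le (one_le_toReal hq hqt)
    simp only [ellNorm, if_neg hqt, ENNReal.mul_rpow_of_nonneg _ _ h0.le]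
    rw [ENNReal.tsum_mul_left, ENNReal.mul_rpow_of_nonneg _ _ (by positivity),
      ← ENNReal.rpow_mul, mul_one_div_cancel h0.ne', ENNReal.rpow_one]

theorem tsum_int_sub (w : ℤ → ℝ≥0∞) (j : ℤ) : ∑' k, w (j - k) = ∑' k, w k :=
  (Equiv.subLeft j).tsum_eq w

/-- Young's inequality for sequences indexed by `ℤ`. -/
theorem ellNorm_conv_le {q : ℝ≥0∞} (hq : 1 ≤ q) (w a : ℤ → ℝ≥0∞) :
    ellNorm q (fun j => ∑' k, w (j - k) * a k) ≤ (∑' i, w i) * ellNorm q a := by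
  by_cases hqt : q = ⊤
  · simp only [ellNorm, if_pos hqt]
    refine iSup_le fun j => ?_
    rw [← tsum_int_sub w j, ← ENNReal.tsum_mul_right]
    exact ENNReal.tsum_le_tsum fun k => by gcongr; exact le_iSup a k
  · rw [ellNorm_eq_eLpNorm' hqt, ellNorm_eq_eLpNorm' hqt]
    have h := eLpNorm'_lintegral_mul_le (μ := (Measure.count : Measure ℤ))
      (one_le_toReal hq hqt) (Measurable.of_discrete (f := w)) (Measurable.of_discrete (f := a))
    simpa only [lintegral_count] using h

/-! ### Geometric sums -/

theorem tsum_two_rpow_neg_abs_ne_top {ε : ℝ} (hε : 0 < ε) :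
    ∑' i : ℤ, (2 : ℝ≥0∞) ^ (-ε * |(i : ℝ)|) ≠ ⊤ := by
  have hr : (2 : ℝ) ^ (-ε) < 1 := Real.rpow_lt_one_of_one_lt_of_neg one_lt_two (by linarith)
  have hs := summable_geometric_of_lt_one (by positivity : (0 : ℝ) ≤ 2 ^ (-ε)) hr
  have h1 : Summable fun i : ℤ => (2 : ℝ) ^ (-ε * |(i : ℝ)|) := by
    refine Summable.of_nat_of_neg ?_ ?_ <;>
    · refine hs.congr fun n => ?_
      rw [← Real.rpow_natCast, ← Real.rpow_mul (by norm_num)]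
      simp
  convert! h1.tsum_ofReal_ne_top using 3 with i
  rw [← ENNReal.ofReal_rpow_of_pos (by norm_num), ENNReal.ofReal_ofNat]

theorem tsum_ite_two_rpow_ne_top {ε : ℝ} (hε : 0 < ε) (N : ℕ) :
    ∑' i : ℤ, (if i ≤ N then (2 : ℝ≥0∞) ^ (ε * (i : ℝ)) else 0) ≠ ⊤ := by
  have h : ∑' i : ℤ, (if i ≤ N then (2 : ℝ≥0∞) ^ (ε * (i : ℝ)) else 0)
      ≤ (2 : ℝ≥0∞) ^ (2 * ε * N) * ∑' i : ℤ, (2 : ℝ≥0∞) ^ (-ε * |(i : ℝ)|) := by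
    rw [← ENNReal.tsum_mul_left]
    refine ENNReal.tsum_le_tsum fun i => ?_
    split_ifs with hi
    · rw [two_rpow_mul_two_rpow]
      refine ENNReal.rpow_le_rpow_of_exponent_le one_le_two ?_
      have h1 : (i : ℝ) + |(i : ℝ)| ≤ 2 * N := by
        have h2 : (i : ℝ) ≤ N := by exact_mod_cast hi
        have h3 : (0 : ℝ) ≤ N := by positivity
        rcases abs_cases (i : ℝ) with h | h <;> linarith
      nlinarith
    · exact zero_le
  exact ne_top_of_le_ne_top
    (ENNReal.mul_ne_top (two_rpow_ne_top _) (tsum_two_rpow_neg_abs_ne_top hε)) h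

/-- The summand decays like $2^{-\delta i}$ upwards and $2^{(1-\delta)i}$ downwards. With
$\delta=s-2/p$ this is where $2/p<s<1+2/p$ enters. -/
theorem tsum_min_two_rpow_ne_top {δ : ℝ} (hδ : 0 < δ) (hδ' : δ < 1) :
    ∑' i : ℤ, min 1 ((2 : ℝ≥0∞) ^ (i : ℝ)) * (2 : ℝ≥0∞) ^ (-δ * (i : ℝ)) ≠ ⊤ := by
  have hε : 0 < min δ (1 - δ) := lt_min hδ (by linarith)
  refine ne_top_of_le_ne_top (tsum_two_rpow_neg_abs_ne_top hε) (ENNReal.tsum_le_tsum fun i => ?_)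
  have hd := min_le_left δ (1 - δ)
  have hd' := min_le_right δ (1 - δ)
  rcases le_total 0 (i : ℝ) with hi | hi
  · calc _ ≤ 1 * (2 : ℝ≥0∞) ^ (-δ * (i : ℝ)) := by gcongr; exact min_le_left _ _
      _ ≤ _ := by
        rw [one_mul, abs_of_nonneg hi]
        refine ENNReal.rpow_le_rpow_of_exponent_le one_le_two ?_
        nlinarith
  · calc _ ≤ (2 : ℝ≥0∞) ^ (i : ℝ) * (2 : ℝ≥0∞) ^ (-δ * (i : ℝ)) := by
          gcongr; exact min_le_right _ _
      _ ≤ _ := by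
        rw [two_rpow_mul_two_rpow, abs_of_nonpos hi]
        refine ENNReal.rpow_le_rpow_of_exponent_le one_le_two ?_
        nlinarith

/-! ### Summation of the majorants -/

theorem tsum_int_sub_right (F : ℤ → ℝ≥0∞) (j : ℤ) : ∑' k, F (k - j) = ∑' k, F k :=
  (Equiv.subRight j).tsum_eq F

theorem tsum_prod_mul (F G : ℤ → ℝ≥0∞) :
    ∑' kl : ℤ × ℤ, F kl.1 * G kl.2 = (∑' k, F k) * ∑' l, G l := by
  rw [ENNReal.tsum_prod', ← ENNReal.tsum_mul_right]
  exact tsum_congr fun k => ENNReal.tsum_mul_left (a := F k) (f := G)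

/-- In each summand of the majorant, the factor measured in sup norm enters only through its uniform
bound `A` or `B`. The factor measured in $L^p$ is kept as a sequence, so that its $\ell^q$
summability survives. -/
theorem exists_tsum_termMajorant_le {p s t : ℝ} (hs : 2 / p < s) (hs' : s < 1 + 2 / p)
    (ht : t < 2 / p) :
    ∃ C : ℝ≥0, ∀ (a b : ℤ → ℝ≥0∞) (A B : ℝ≥0∞),
      (∀ k : ℤ, (2 : ℝ≥0∞) ^ ((k : ℝ) * s) * a k ≤ A) →
      (∀ l : ℤ, (2 : ℝ≥0∞) ^ ((l : ℝ) * t) * b l ≤ B) →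
      ∀ j : ℤ, ∑' kl : ℤ × ℤ, Bump.termMajorant p a b j kl.1 kl.2
        ≤ C * (2 : ℝ≥0∞) ^ (-(s + t - 2 / p) * (j : ℝ)) *
          (A * ∑' l : ℤ, (if |j - l| ≤ 3 then 1 else 0) * ((2 : ℝ≥0∞) ^ ((l : ℝ) * t) * b l)
          + B * ∑' k : ℤ, (if j - k ≤ (8 : ℕ) then
              (2 : ℝ≥0∞) ^ ((s + t - 2 / p) * ((j - k : ℤ) : ℝ)) else 0) * ((2 : ℝ≥0∞) ^ ((k : ℝ) * s) * a k)) := by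
  set δ := s - 2 / p with hδ
  set τ := 2 / p - t with hτ
  set S₁ := ∑' i : ℤ, min 1 ((2 : ℝ≥0∞) ^ (i : ℝ)) * (2 : ℝ≥0∞) ^ (-δ * (i : ℝ)) with hS₁
  set S₂ := ∑' i : ℤ, (if i ≤ (5 : ℕ) then (2 : ℝ≥0∞) ^ (τ * (i : ℝ)) else 0) with hS₂
  have hS₁t : S₁ ≠ ⊤ := tsum_min_two_rpow_ne_top (by linarith) (by linarith)
  have hS₂t : S₂ ≠ ⊤ := tsum_ite_two_rpow_ne_top (by linarith) 5
  set D : ℝ≥0∞ := (2 : ℝ≥0∞) ^ (3 * |t|)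
  have hD : D ≠ ⊤ := two_rpow_ne_top _
  refine ⟨(D * S₁).toNNReal + S₂.toNNReal, fun a b A B hA hB j => ?_⟩
  rw [ENNReal.coe_add, ENNReal.coe_toNNReal (ENNReal.mul_ne_top hD hS₁t),
    ENNReal.coe_toNNReal hS₂t]
  set E := (2 : ℝ≥0∞) ^ (-(s + t - 2 / p) * (j : ℝ)) with hE
  set X := ∑' l : ℤ, (if |j - l| ≤ 3 then 1 else 0) * ((2 : ℝ≥0∞) ^ ((l : ℝ) * t) * b l) with hX
  set Y := ∑' k : ℤ, (if j - k ≤ (8 : ℕ) then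
    (2 : ℝ≥0∞) ^ ((s + t - 2 / p) * ((j - k : ℤ) : ℝ)) else 0)
      * ((2 : ℝ≥0∞) ^ ((k : ℝ) * s) * a k) with hY
  have h1 : ∑' kl : ℤ × ℤ, (if |kl.2 - j| ≤ 3 then min 1 ((2 : ℝ≥0∞) ^ ((kl.1 - j : ℤ) : ℝ))
      * ((2 : ℝ≥0∞) ^ ((kl.1 : ℝ) * (2 / p)) * a kl.1) * b kl.2 else 0) ≤ D * S₁ * E * (A * X) := by
    have h2 : ∀ k : ℤ, (2 : ℝ≥0∞) ^ ((k : ℝ) * (2 / p)) * a k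
        ≤ (2 : ℝ≥0∞) ^ (-δ * ((k - j : ℤ) : ℝ)) * ((2 : ℝ≥0∞) ^ (-δ * (j : ℝ)) * A) := by
      intro k
      calc _ = (2 : ℝ≥0∞) ^ (-δ * (k : ℝ)) * ((2 : ℝ≥0∞) ^ ((k : ℝ) * s) * a k) := by
            rw [← mul_assoc, two_rpow_mul_two_rpow]
            congr 2
            rw [hδ]; ring
        _ ≤ (2 : ℝ≥0∞) ^ (-δ * (k : ℝ)) * A := by gcongr; exact hA k
        _ = _ := by
            rw [← mul_assoc, two_rpow_mul_two_rpow]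
            congr 2
            push_cast; ring
    -- `D` is the cost of replacing $2^{-lt}$ by $2^{-jt}$ when $|l-j|\le3$.
    have h3 : ∀ l : ℤ, (if |l - j| ≤ 3 then b l else 0)
        ≤ D * (2 : ℝ≥0∞) ^ (-t * (j : ℝ)) * ((if |j - l| ≤ 3 then 1 else 0) *
          ((2 : ℝ≥0∞) ^ ((l : ℝ) * t) * b l)) := by
      intro l
      rw [abs_sub_comm]
      split_ifs with hl
      · rw [one_mul, ← mul_assoc, two_rpow_mul_two_rpow, two_rpow_mul_two_rpow]
        refine le_mul_of_one_le_left' ?_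
        rw [← ENNReal.rpow_zero (x := 2)]
        refine ENNReal.rpow_le_rpow_of_exponent_le one_le_two ?_
        have h4 : |(j : ℝ) - l| ≤ 3 := by exact_mod_cast hl
        have h5 : t * ((j : ℝ) - l) ≤ |t| * 3 := by
          refine (le_abs_self _).trans ?_
          rw [abs_mul]
          gcongr
        linarith
      · exact zero_le
    calc _ ≤ ∑' kl : ℤ × ℤ, (min 1 ((2 : ℝ≥0∞) ^ ((kl.1 - j : ℤ) : ℝ))
          * (2 : ℝ≥0∞) ^ (-δ * ((kl.1 - j : ℤ) : ℝ))) * (((2 : ℝ≥0∞) ^ (-δ * (j : ℝ)) * A) *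
          (D * (2 : ℝ≥0∞) ^ (-t * (j : ℝ)) * ((if |j - kl.2| ≤ 3 then 1 else 0) *
          ((2 : ℝ≥0∞) ^ ((kl.2 : ℝ) * t) * b kl.2)))) := by
          refine ENNReal.tsum_le_tsum fun kl => ?_
          calc _ = min 1 ((2 : ℝ≥0∞) ^ ((kl.1 - j : ℤ) : ℝ))
              * ((2 : ℝ≥0∞) ^ ((kl.1 : ℝ) * (2 / p)) * a kl.1) *
                (if |kl.2 - j| ≤ 3 then b kl.2 else 0) := by
                split_ifs <;> simp
            _ ≤ min 1 ((2 : ℝ≥0∞) ^ ((kl.1 - j : ℤ) : ℝ))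
              * ((2 : ℝ≥0∞) ^ (-δ * ((kl.1 - j : ℤ) : ℝ)) * ((2 : ℝ≥0∞) ^ (-δ * (j : ℝ)) * A)) *
                (D * (2 : ℝ≥0∞) ^ (-t * (j : ℝ)) * ((if |j - kl.2| ≤ 3 then 1 else 0) *
          ((2 : ℝ≥0∞) ^ ((kl.2 : ℝ) * t) * b kl.2))) :=
                mul_le_mul' (mul_le_mul' le_rfl (h2 _)) (h3 _)
            _ = _ := by ring
      _ = S₁ * (((2 : ℝ≥0∞) ^ (-δ * (j : ℝ)) * A) * (D * (2 : ℝ≥0∞) ^ (-t * (j : ℝ)) * X)) := by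
          rw [hS₁, hX, ← ENNReal.tsum_mul_left, ← ENNReal.tsum_mul_left, ← tsum_int_sub_right
            (fun i => min 1 ((2 : ℝ≥0∞) ^ (i : ℝ)) * (2 : ℝ≥0∞) ^ (-δ * (i : ℝ))) j]
          exact tsum_prod_mul
            (fun k => min 1 ((2 : ℝ≥0∞) ^ ((k - j : ℤ) : ℝ))
              * (2 : ℝ≥0∞) ^ (-δ * ((k - j : ℤ) : ℝ)))
            (fun l => ((2 : ℝ≥0∞) ^ (-δ * (j : ℝ)) * A) *
              (D * (2 : ℝ≥0∞) ^ (-t * (j : ℝ)) * ((if |j - l| ≤ 3 then 1 else 0) *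
                ((2 : ℝ≥0∞) ^ ((l : ℝ) * t) * b l))))
      _ = D * S₁ * ((2 : ℝ≥0∞) ^ (-δ * (j : ℝ)) * (2 : ℝ≥0∞) ^ (-t * (j : ℝ))) * (A * X) := by
          ring
      _ = _ := by
          rw [two_rpow_mul_two_rpow, hE]
          congr 4
          rw [hδ]; ring
  have h2 : ∑' kl : ℤ × ℤ, (if j ≤ kl.1 + 8 ∧ kl.2 ≤ kl.1 + 5 then
      a kl.1 * ((2 : ℝ≥0∞) ^ ((kl.2 : ℝ) * (2 / p)) * b kl.2) else 0) ≤ S₂ * E * (B * Y) := by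
    have h3 : ∀ l : ℤ, (2 : ℝ≥0∞) ^ ((l : ℝ) * (2 / p)) * b l ≤ (2 : ℝ≥0∞) ^ (τ * (l : ℝ)) * B := by
      intro l
      calc _ = (2 : ℝ≥0∞) ^ (τ * (l : ℝ)) * ((2 : ℝ≥0∞) ^ ((l : ℝ) * t) * b l) := by
            rw [← mul_assoc, two_rpow_mul_two_rpow]
            congr 2
            rw [hτ]; ring
        _ ≤ _ := by gcongr; exact hB l
    -- With $\sigma=s+t-2/p$ one has $s-\sigma=\tau$, so the factor $2^{\tau k}$ left by the sum
    -- over $l\le k+5$ turns into a convolution kernel in $j-k$.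
    have h4 : ∀ k : ℤ, (if j ≤ k + 8 then a k * (2 : ℝ≥0∞) ^ (τ * (k : ℝ)) else 0)
        = E * ((if j - k ≤ (8 : ℕ) then (2 : ℝ≥0∞) ^ ((s + t - 2 / p) * ((j - k : ℤ) : ℝ)) else 0)
          * ((2 : ℝ≥0∞) ^ ((k : ℝ) * s) * a k)) := by
      intro k
      by_cases hk : j ≤ k + 8
      · rw [if_pos hk, if_pos (by push_cast; omega), hE, ← mul_assoc, ← mul_assoc,
          two_rpow_mul_two_rpow, two_rpow_mul_two_rpow, mul_comm]
        congr 2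
        rw [hτ]; push_cast; ring
      · rw [if_neg hk, if_neg (by push_cast; omega), zero_mul, mul_zero]
    have h5 : ∀ k l : ℤ, (if j ≤ k + 8 ∧ l ≤ k + 5 then
        a k * ((2 : ℝ≥0∞) ^ ((l : ℝ) * (2 / p)) * b l) else 0)
        ≤ (if j ≤ k + 8 then a k * (2 : ℝ≥0∞) ^ (τ * (k : ℝ)) else 0) *
          ((if l - k ≤ (5 : ℕ) then (2 : ℝ≥0∞) ^ (τ * ((l - k : ℤ) : ℝ)) else 0) * B) := by
      intro k l
      split_ifs with h h' h'' h''
      · calc _ ≤ a k * ((2 : ℝ≥0∞) ^ (τ * (l : ℝ)) * B) := mul_le_mul' le_rfl (h3 l)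
          _ = a k * ((2 : ℝ≥0∞) ^ (τ * (k : ℝ)) * (2 : ℝ≥0∞) ^ (τ * ((l - k : ℤ) : ℝ)) * B) := by
              rw [two_rpow_mul_two_rpow]
              congr 3
              push_cast; ring
          _ ≤ _ := le_of_eq (by ring)
      all_goals first | exact zero_le | (exfalso; push_cast at *; omega)
    calc _ ≤ ∑' kl : ℤ × ℤ,
          (if j ≤ kl.1 + 8 then a kl.1 * (2 : ℝ≥0∞) ^ (τ * (kl.1 : ℝ)) else 0) *
          ((if kl.2 - kl.1 ≤ (5 : ℕ) then
            (2 : ℝ≥0∞) ^ (τ * ((kl.2 - kl.1 : ℤ) : ℝ)) else 0) * B) :=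
          ENNReal.tsum_le_tsum fun kl => h5 kl.1 kl.2
      _ = ∑' k : ℤ, (if j ≤ k + 8 then a k * (2 : ℝ≥0∞) ^ (τ * (k : ℝ)) else 0) * (S₂ * B) := by
          rw [ENNReal.tsum_prod']
          refine tsum_congr fun k => ?_
          rw [hS₂, ← tsum_int_sub_right
            (fun i : ℤ => if i ≤ (5 : ℕ) then (2 : ℝ≥0∞) ^ (τ * (i : ℝ)) else 0) k,
            ← ENNReal.tsum_mul_right, ← ENNReal.tsum_mul_left]
      _ = _ := by
          simp only [h4]
          rw [ENNReal.tsum_mul_right, ENNReal.tsum_mul_left]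
          ring
  calc _ ≤ D * S₁ * E * (A * X) + S₂ * E * (B * Y) := by
        simp only [Bump.termMajorant]
        rw [ENNReal.tsum_add]
        exact add_le_add h1 h2
    _ ≤ (D * S₁ + S₂) * E * (A * X) + (D * S₁ + S₂) * E * (B * Y) := by
        gcongr
        · exact le_self_add
        · exact le_add_self
    _ = _ := by ring

/-! ### Countable sums in `L^p` -/

section CountableSum

variable {X ι : Type*} [MeasurableSpace X] {μ : Measure X} [Countable ι]

/-- Minkowski's inequality for countable sums. -/
theorem eLpNorm'_tsum_le {p : ℝ} (hp : 1 ≤ p) {u : ι → X → ℝ≥0∞}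
    (hu : ∀ i, AEMeasurable (u i) μ) :
    eLpNorm' (fun x => ∑' i, u i x) p μ ≤ ∑' i, eLpNorm' (u i) p μ := by
  have h0 : 0 < p := zero_lt_one.trans_le hp
  have hm : ∀ S : Finset ι, AEMeasurable (fun x => ∑ i ∈ S, u i x) μ :=
    fun S => Finset.aemeasurable_fun_sum S fun i _ => hu i
  -- Monotone convergence along the directed family of finite subsets; countability of the index
  -- makes it applicable.
  have h1 : ∫⁻ x, (∑' i, u i x) ^ p ∂μ = ⨆ S : Finset ι, ∫⁻ x, (∑ i ∈ S, u i x) ^ p ∂μ := by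
    rw [← lintegral_iSup_directed (fun S => (hm S).pow_const p)]
    · refine lintegral_congr fun x => ?_
      rw [ENNReal.tsum_eq_iSup_sum]
      exact (ENNReal.orderIsoRpow p h0).map_iSup _
    · refine Monotone.directed_le fun S T hST x => ?_
      exact ENNReal.rpow_le_rpow (Finset.sum_le_sum_of_subset hST) h0.le
  have h2 : eLpNorm' (fun x => ∑' i, u i x) p μ
      = ⨆ S : Finset ι, eLpNorm' (fun x => ∑ i ∈ S, u i x) p μ := by
    simp only [eLpNorm', enorm_eq_self, h1]
    exact (ENNReal.orderIsoRpow (1 / p) (by positivity)).map_iSup _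
  rw [h2]
  refine iSup_le fun S => ?_
  have h3 := eLpNorm'_sum_le (s := S) (f := u) (fun i _ => (hu i).aestronglyMeasurable) hp
  refine le_trans (le_of_eq ?_) (h3.trans (ENNReal.sum_le_tsum S))
  congr 1
  ext x
  simp

variable {E : Type*} [NormedAddCommGroup E]

theorem eLpNorm'_tsum_le_of_le {p : ℝ} (hp : 1 ≤ p) {T : ι → X → E} {w : ι → ℝ≥0∞}
    (hT : ∀ i, AEStronglyMeasurable (T i) μ) (hw : ∀ i, eLpNorm' (T i) p μ ≤ w i) :
    eLpNorm' (fun x => ∑' i, T i x) p μ ≤ ∑' i, w i := by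
  have h1 : eLpNorm' (fun x => ∑' i, T i x) p μ ≤ eLpNorm' (fun x => ∑' i, ‖T i x‖ₑ) p μ :=
    eLpNorm'_mono_enorm_ae (zero_le_one.trans hp)
      (Eventually.of_forall fun x => enorm_tsum_le_tsum_enorm)
  refine h1.trans ((eLpNorm'_tsum_le hp fun i => (hT i).enorm).trans
    (ENNReal.tsum_le_tsum fun i => ?_))
  rw [eLpNorm'_enorm]
  exact hw i

theorem aestronglyMeasurable_tsum {T : ι → X → E} (hT : ∀ i, AEStronglyMeasurable (T i) μ)
    (hs : ∀ x, Summable fun i => T i x) :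
    AEStronglyMeasurable (fun x => ∑' i, T i x) μ :=
  aestronglyMeasurable_of_tendsto_ae (atTop : Filter (Finset ι))
    (f := fun S x => ∑ i ∈ S, T i x)
    (fun S => Finset.aestronglyMeasurable_fun_sum S fun i _ => hT i)
    (Eventually.of_forall fun x => (hs x).hasSum)

theorem tendsto_eLpNorm'_sum_sub_tsum [CompleteSpace E] {p : ℝ} (hp : 1 ≤ p) {T : ι → X → E}
    {w : ι → ℝ≥0∞}
    (hT : ∀ i, AEStronglyMeasurable (T i) μ) (hw : ∀ i, eLpNorm' (T i) p μ ≤ w i)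
    (hwt : ∑' i, w i ≠ ⊤) (hs : ∀ x, Summable fun i => T i x) :
    Tendsto (fun S : Finset ι => eLpNorm' (fun x => (∑ i ∈ S, T i x) - ∑' i, T i x) p μ)
      atTop (𝓝 0) := by
  refine tendsto_of_tendsto_of_tendsto_of_le_of_le tendsto_const_nhds
    (ENNReal.tendsto_tsum_compl_atTop_zero hwt) (fun S => zero_le) fun S => ?_
  have h1 : (fun x => (∑ i ∈ S, T i x) - ∑' i, T i x)
      = -fun x => ∑' i : {i // i ∉ S}, T i x := by
    ext x
    rw [Pi.neg_apply, ← (hs x).sum_add_tsum_subtype_compl S]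
    abel
  have h2 : ∀ F : X → E, eLpNorm' (-F) p μ = eLpNorm' F p μ := fun F => eLpNorm'_neg ..
  dsimp only
  rw [h1, h2]
  exact eLpNorm'_tsum_le_of_le hp (fun i => hT i) fun i => hw i

end CountableSum

theorem summable_of_enorm_le {ι E : Type*} [NormedAddCommGroup E] [CompleteSpace E] {z : ι → E}
    {w : ι → ℝ≥0∞} {M : ℝ≥0∞} (hM : M ≠ ⊤) (hw : ∑' i, w i ≠ ⊤) (h : ∀ i, ‖z i‖ₑ ≤ M * w i) :
    Summable z := by
  refine (tsum_enorm_ne_top_iff_summable_norm.1 (ne_top_of_le_ne_top ?_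
    (ENNReal.tsum_le_tsum h))).of_norm
  rw [ENNReal.tsum_mul_left]
  exact ENNReal.mul_ne_top hM hw

theorem tsum_ite_abs_le_ne_top :
    ∑' i : ℤ, (if |i| ≤ 3 then (1 : ℝ≥0∞) else 0) ≠ ⊤ := by
  rw [tsum_eq_sum (s := Finset.Icc (-3) 3)]
  · refine ENNReal.sum_ne_top.2 fun i _ => ?_
    split_ifs <;> simp
  · intro i hi
    rw [if_neg]
    rwa [abs_le, ← Finset.mem_Icc]

/-! ### Convergence of the double series and the $\ell^q$ bound. -/

namespace Bump

variable (ψ : Bump)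

theorem exists_comm_bound {p s t : ℝ} {q : ℝ≥0∞} (hp : 1 < p) (hq : 1 ≤ q)
    (hs : 2 / p < s) (hs' : s < 1 + 2 / p) (ht : t < 2 / p) (hst : 2 / p < s + t) :
    ∃ C : ℝ≥0, ∀ f ∈ ψ.besov s (ENNReal.ofReal p) q, ∀ g ∈ ψ.besov t (ENNReal.ofReal p) q,
      (∀ j x, Summable fun kl => ψ.commTerm j f g kl x) ∧
      (∀ j, MemLp (ψ.comm j f g) (ENNReal.ofReal p) volume) ∧
      (∀ j, Tendsto (fun S : Finset (ℤ × ℤ) => eLpNorm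
        (fun x => (∑ kl ∈ S, ψ.commTerm j f g kl x) - ψ.comm j f g x) (ENNReal.ofReal p) volume)
        atTop (𝓝 0)) ∧
      ellNorm q (fun j => (2 : ℝ≥0∞) ^ ((s + t - 2 / p) * (j : ℝ))
        * eLpNorm (ψ.comm j f g) (ENNReal.ofReal p) volume)
        ≤ C * (ψ.besovNorm s (ENNReal.ofReal p) q f * ψ.besovNorm t (ENNReal.ofReal p) q g) := by
  obtain ⟨C₁, hC₁⟩ := ψ.exists_commTerm_bound hp
  obtain ⟨C₂, hC₂⟩ := exists_tsum_termMajorant_le hs hs' ht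
  have hp0 : 0 < p := by linarith
  have hLp : ∀ u : Plane → ℂ, eLpNorm u (ENNReal.ofReal p) volume = eLpNorm' u p volume := by
    intro u
    rw [eLpNorm_eq_eLpNorm' (by simpa using hp0) ENNReal.ofReal_ne_top,
      ENNReal.toReal_ofReal hp0.le]
  have hσ : 0 < s + t - 2 / p := by linarith
  set W₁ := ∑' i : ℤ, (if |i| ≤ 3 then (1 : ℝ≥0∞) else 0) with hW₁
  set W₂ := ∑' i : ℤ, (if i ≤ (8 : ℕ) then (2 : ℝ≥0∞) ^ ((s + t - 2 / p) * (i : ℝ)) else 0)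
    with hW₂
  have hW₁t : W₁ ≠ ⊤ := tsum_ite_abs_le_ne_top
  have hW₂t : W₂ ≠ ⊤ := tsum_ite_two_rpow_ne_top hσ 8
  refine ⟨C₁ * C₂ * (W₁.toNNReal + W₂.toNNReal), fun f hf g hg => ?_⟩
  replace hf : ψ.besovNorm s (ENNReal.ofReal p) q f < ⊤ := hf
  replace hg : ψ.besovNorm t (ENNReal.ofReal p) q g < ⊤ := hg
  set A := ψ.besovNorm s (ENNReal.ofReal p) q f with hA
  set B := ψ.besovNorm t (ENNReal.ofReal p) q g with hB
  set a := fun k : ℤ => eLpNorm' (ψ.block k f) p volume with ha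
  set b := fun l : ℤ => eLpNorm' (ψ.block l g) p volume with hb
  have hA' : A = ellNorm q fun k : ℤ => (2 : ℝ≥0∞) ^ ((k : ℝ) * s) * a k := by
    simp only [hA, besovNorm, hLp, ha]
  have hB' : B = ellNorm q fun l : ℤ => (2 : ℝ≥0∞) ^ ((l : ℝ) * t) * b l := by
    simp only [hB, besovNorm, hLp, hb]
  have hAk : ∀ k : ℤ, (2 : ℝ≥0∞) ^ ((k : ℝ) * s) * a k ≤ A := fun k => by
    rw [hA']
    exact le_ellNorm hq (fun k : ℤ => (2 : ℝ≥0∞) ^ ((k : ℝ) * s) * a k) k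
  have hBl : ∀ l : ℤ, (2 : ℝ≥0∞) ^ ((l : ℝ) * t) * b l ≤ B := fun l => by
    rw [hB']
    exact le_ellNorm hq (fun l : ℤ => (2 : ℝ≥0∞) ^ ((l : ℝ) * t) * b l) l
  have hne : ∀ (r : ℝ) (m M : ℝ≥0∞), M < ⊤ → (2 : ℝ≥0∞) ^ r * m ≤ M → m ≠ ⊤ := by
    rintro r m M hM h rfl
    rw [ENNReal.mul_top (by simp [ENNReal.rpow_eq_zero_iff])] at h
    exact absurd hM (not_lt.2 h)
  have hat : ∀ k, a k ≠ ⊤ := fun k => hne _ _ _ hf (hAk k)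
  have hbt : ∀ l, b l ≠ ⊤ := fun l => hne _ _ _ hg (hBl l)
  set w := fun (j : ℤ) (kl : ℤ × ℤ) => C₁ * termMajorant p a b j kl.1 kl.2 with hw
  have hT : ∀ j (kl : ℤ × ℤ), BernsteinBound p j (ψ.commTerm j f g kl) (w j kl) :=
    fun j kl => hC₁ f g hat hbt j kl.1 kl.2
  set P := fun j : ℤ => ∑' l : ℤ, (if |j - l| ≤ 3 then 1 else 0)
    * ((2 : ℝ≥0∞) ^ ((l : ℝ) * t) * b l) with hP
  set Q := fun j : ℤ => ∑' k : ℤ, (if j - k ≤ (8 : ℕ) then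
    (2 : ℝ≥0∞) ^ ((s + t - 2 / p) * ((j - k : ℤ) : ℝ)) else 0)
      * ((2 : ℝ≥0∞) ^ ((k : ℝ) * s) * a k) with hQ
  have hwj : ∀ j : ℤ, ∑' kl, w j kl ≤ C₁ * (C₂ * (2 : ℝ≥0∞) ^ (-(s + t - 2 / p) * (j : ℝ)) *
      (A * P j + B * Q j)) := fun j => by
    rw [hw, ENNReal.tsum_mul_left]
    exact mul_le_mul' le_rfl (hC₂ a b A B hAk hBl j)
  have hPn : ellNorm q P ≤ W₁ * B := by
    rw [hB']
    exact ellNorm_conv_le hq (fun i => if |i| ≤ 3 then 1 else 0) _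
  have hQn : ellNorm q Q ≤ W₂ * A := by
    rw [hA']
    exact ellNorm_conv_le hq
      (fun i : ℤ => if i ≤ (8 : ℕ) then (2 : ℝ≥0∞) ^ ((s + t - 2 / p) * (i : ℝ)) else 0) _
  have hPj : ∀ j, P j ≠ ⊤ := fun j => ne_top_of_le_ne_top
    (ENNReal.mul_ne_top hW₁t hg.ne) ((le_ellNorm hq P j).trans hPn)
  have hQj : ∀ j, Q j ≠ ⊤ := fun j => ne_top_of_le_ne_top
    (ENNReal.mul_ne_top hW₂t hf.ne) ((le_ellNorm hq Q j).trans hQn)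
  have hwt : ∀ j, ∑' kl, w j kl ≠ ⊤ := fun j => by
    refine ne_top_of_le_ne_top (ENNReal.mul_ne_top ENNReal.coe_ne_top (ENNReal.mul_ne_top
      (ENNReal.mul_ne_top ENNReal.coe_ne_top (two_rpow_ne_top _))
      (ENNReal.add_ne_top.2 ⟨ENNReal.mul_ne_top hf.ne (hPj j),
        ENNReal.mul_ne_top hg.ne (hQj j)⟩))) (hwj j)
  -- The pointwise half of `BernsteinBound` carries the factor $2^{2j/p}$, constant in $(k,l)$, so
  -- the finite majorant sum gives absolute convergence at every point.
  have hsum : ∀ j x, Summable fun kl => ψ.commTerm j f g kl x := fun j x =>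
    summable_of_enorm_le (two_rpow_ne_top _) (hwt j) fun kl => (hT j kl).2 x
  have hmeas : ∀ j kl, AEStronglyMeasurable (ψ.commTerm j f g kl) volume :=
    fun j => ψ.aestronglyMeasurable_commTerm j f g
  have hcomm : ∀ j, eLpNorm' (ψ.comm j f g) p volume ≤ ∑' kl, w j kl := fun j =>
    eLpNorm'_tsum_le_of_le hp.le (hmeas j) fun kl => (hT j kl).1
  refine ⟨hsum, fun j => ⟨aestronglyMeasurable_tsum (hmeas j) (hsum j), ?_⟩, fun j => ?_, ?_⟩
  · rw [hLp]
    exact (hcomm j).trans_lt (hwt j).lt_top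
  · simp only [hLp]
    exact tendsto_eLpNorm'_sum_sub_tsum hp.le (hmeas j) (fun kl => (hT j kl).1) (hwt j) (hsum j)
  · have h1 : ∀ j : ℤ, (2 : ℝ≥0∞) ^ ((s + t - 2 / p) * (j : ℝ))
        * eLpNorm (ψ.comm j f g) (ENNReal.ofReal p) volume
        ≤ (C₁ * C₂ : ℝ≥0∞) * (A * P j + B * Q j) := by
      intro j
      have h2 : (2 : ℝ≥0∞) ^ ((s + t - 2 / p) * (j : ℝ))
          * (2 : ℝ≥0∞) ^ (-(s + t - 2 / p) * (j : ℝ)) = 1 := by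
        rw [two_rpow_mul_two_rpow, ← ENNReal.rpow_zero (x := 2)]
        congr 1
        ring
      rw [hLp]
      calc _ ≤ (2 : ℝ≥0∞) ^ ((s + t - 2 / p) * (j : ℝ)) * (C₁ * (C₂ *
            (2 : ℝ≥0∞) ^ (-(s + t - 2 / p) * (j : ℝ)) * (A * P j + B * Q j))) :=
            mul_le_mul' le_rfl ((hcomm j).trans (hwj j))
        _ = ((2 : ℝ≥0∞) ^ ((s + t - 2 / p) * (j : ℝ))
          * (2 : ℝ≥0∞) ^ (-(s + t - 2 / p) * (j : ℝ))) * (C₁ * C₂ * (A * P j + B * Q j)) := by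
            ring
        _ = _ := by rw [h2, one_mul]
    calc _ ≤ ellNorm q (fun j => (C₁ * C₂ : ℝ≥0∞) * (A * P j + B * Q j)) := ellNorm_mono h1
      _ = C₁ * C₂ * ellNorm q (fun j => A * P j + B * Q j) := ellNorm_const_mul hq _ _
      _ ≤ C₁ * C₂ * (ellNorm q (fun j => A * P j) + ellNorm q (fun j => B * Q j)) :=
          mul_le_mul' le_rfl (ellNorm_add_le hq _ _)
      _ = C₁ * C₂ * (A * ellNorm q P + B * ellNorm q Q) := by
          rw [ellNorm_const_mul hq A P, ellNorm_const_mul hq B Q]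
      _ ≤ C₁ * C₂ * (A * (W₁ * B) + B * (W₂ * A)) := by gcongr
      _ = _ := by
          push_cast
          rw [ENNReal.coe_toNNReal hW₁t, ENNReal.coe_toNNReal hW₂t]
          ring

end Bump

/-- A sequence with finite `ℓ^q` norm at most `M` is `M` times a sequence in the unit ball. -/
theorem exists_le_mul_of_ellNorm_le {q : ℝ≥0∞} (hq : 1 ≤ q) {e : ℤ → ℝ≥0∞} {M : ℝ≥0∞}
    (hM : M ≠ ⊤) (h : ellNorm q e ≤ M) :
    ∃ c : ℤ → ℝ≥0, ellNorm q (fun j => (c j : ℝ≥0∞)) ≤ 1 ∧ ∀ j, e j ≤ M * c j := by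
  -- For `M = 0` all $e_j$ vanish and dividing by `M` is meaningless, so `c = 0` is taken; otherwise
  -- $c_j=e_j/M$.
  by_cases hM0 : M = 0
  · have h0 : ellNorm q (fun _ => ((0 : ℝ≥0) : ℝ≥0∞)) = 0 := by
      simpa using ellNorm_const_mul hq 0 e
    refine ⟨fun _ => 0, h0.le.trans zero_le_one, fun j => ?_⟩
    have := (le_ellNorm hq e j).trans h
    simpa [hM0] using this
  · have hej : ∀ j, e j ≠ ⊤ := fun j => ne_top_of_le_ne_top hM ((le_ellNorm hq e j).trans h)
    have hc : ∀ j, (((M⁻¹ * e j).toNNReal : ℝ≥0) : ℝ≥0∞) = M⁻¹ * e j := fun j =>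
      ENNReal.coe_toNNReal (ENNReal.mul_ne_top (ENNReal.inv_ne_top.2 hM0) (hej j))
    refine ⟨fun j => (M⁻¹ * e j).toNNReal, ?_, fun j => ?_⟩
    · simp only [hc]
      rw [ellNorm_const_mul hq]
      calc M⁻¹ * ellNorm q e ≤ M⁻¹ * M := by gcongr
        _ = 1 := ENNReal.inv_mul_cancel hM0 hM
    · rw [hc, ← mul_assoc, ENNReal.mul_inv_cancel hM0 hM, one_mul]

/-! ### Littlewood–Paley expansion of Schwartz functions -/

theorem hasSum_prod_mul {f g : ℤ → ℂ} {a b : ℂ} (hf : HasSum f a) (hg : HasSum g b) :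
    HasSum (fun kl : ℤ × ℤ => f kl.1 * g kl.2) (a * b) :=
  hf.mul hg (summable_mul_of_summable_norm (summable_norm_iff.2 hf.summable)
    (summable_norm_iff.2 hg.summable))

namespace Bump

variable (ψ : Bump)

theorem norm_phi_le_one (k : ℤ) (ξ : Plane) : ‖(ψ.phi k ξ : ℂ)‖ ≤ 1 := by
  rw [Complex.norm_real, Real.norm_eq_abs, phi_eq_sub, abs_le]
  have h1 := ψ.nonneg ((2 : ℝ) ^ (-(k + 1)) • ξ)
  have h2 := ψ.le_one ((2 : ℝ) ^ (-(k + 1)) • ξ)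
  have h3 := ψ.nonneg ((2 : ℝ) ^ (-k) • ξ)
  have h4 := ψ.le_one ((2 : ℝ) ^ (-k) • ξ)
  constructor <;> linarith

/-- At each `ξ ≠ 0` only two consecutive `φₖ` are nonzero, and they add up to `1`. -/
theorem exists_phi_add_phi_eq_one {ξ : Plane} (hξ : ξ ≠ 0) :
    ∃ m : ℤ, (∀ k, k ∉ ({m, m + 1} : Finset ℤ) → ψ.phi k ξ = 0) ∧
      ψ.phi m ξ + ψ.phi (m + 1) ξ = 1 := by
  obtain ⟨m, hm, hm'⟩ := exists_mem_Ioc_zpow (norm_pos_iff.2 hξ) one_lt_two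
  refine ⟨m, fun k hk => ?_, ?_⟩
  · by_contra h
    have h1 := (zpow_lt_zpow_iff_right₀ one_lt_two).1
      ((ψ.lt_norm_of_phi_ne_zero h).trans_le hm')
    have h2 := (zpow_lt_zpow_iff_right₀ one_lt_two).1
      (hm.trans_le (ψ.norm_le_of_phi_ne_zero h))
    simp only [Finset.mem_insert, Finset.mem_singleton] at hk
    omega
  · rw [phi_eq_sub, phi_eq_sub, ψ.toFun_zpow_smul_eq_zero hm, ψ.toFun_zpow_smul_eq_one
      (j := m + 1 + 1) (by simpa using hm')]
    ring

theorem hasSum_phi {ξ : Plane} (hξ : ξ ≠ 0) : HasSum (fun k => (ψ.phi k ξ : ℂ)) 1 := by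
  obtain ⟨m, hm, hm'⟩ := ψ.exists_phi_add_phi_eq_one hξ
  have h := hasSum_sum_of_ne_finset_zero (L := .unconditional ℤ) (f := fun k => (ψ.phi k ξ : ℂ))
    (s := {m, m + 1}) fun k hk => by rw [hm k hk, Complex.ofReal_zero]
  rw [Finset.sum_pair (by omega), ← Complex.ofReal_add, hm', Complex.ofReal_one] at h
  exact h

theorem tsum_enorm_phi_le {ξ : Plane} (hξ : ξ ≠ 0) : ∑' k, ‖(ψ.phi k ξ : ℂ)‖ₑ ≤ 2 := by
  obtain ⟨m, hm, -⟩ := ψ.exists_phi_add_phi_eq_one hξ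
  have h1 : ∀ k, ‖(ψ.phi k ξ : ℂ)‖ₑ ≤ 1 := fun k => by
    rw [← ofReal_norm, ← ENNReal.ofReal_one]
    exact ENNReal.ofReal_le_ofReal (ψ.norm_phi_le_one k ξ)
  rw [tsum_eq_sum (s := {m, m + 1}) fun k hk => by rw [hm k hk]; simp,
    Finset.sum_pair (by omega), ← one_add_one_eq_two]
  exact add_le_add (h1 _) (h1 _)

theorem block_ofSchwartz (k : ℤ) (F : 𝓢(Plane, ℂ)) (x : Plane) :
    ψ.block k (ofSchwartz F) x
      = ∫ ξ, Real.fourierChar (inner ℝ ξ x) • ((ψ.phi k ξ : ℂ) * 𝓕 (F : Plane → ℂ) ξ) := by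
  have h1 : ψ.block k (ofSchwartz F) x = ψ.blockFun k F x := by
    rw [block, ofSchwartz_apply, blockFun]
    simp only [kernelAt_apply]
  have h2 : (𝓕 (SchwartzMap.convolution (ContinuousLinearMap.mul ℂ ℂ) (ψ.kernel k) F)
      : 𝓢(Plane, ℂ)) = pairing (ContinuousLinearMap.mul ℂ ℂ) (ψ.phiS k) (𝓕 F) := by
    rw [SchwartzMap.fourier_convolution, fourier_kernel]
  rw [h1, blockFun_schwartz,
    ← FourierTransform.fourierInv_fourier_eq (F := 𝓢(Plane, ℂ))
      (SchwartzMap.convolution (ContinuousLinearMap.mul ℂ ℂ) (ψ.kernel k) F), h2,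
    SchwartzMap.fourierInv_coe, Real.fourierInv_eq]
  rfl

theorem integrable_phi_mul (k : ℤ) (F : 𝓢(Plane, ℂ)) :
    Integrable fun ξ => (ψ.phi k ξ : ℂ) * 𝓕 (F : Plane → ℂ) ξ :=
  (pairing (ContinuousLinearMap.mul ℂ ℂ) (ψ.phiS k) (𝓕 F)).integrable

/-- At most two $\varphi_k$ overlap off the null set $\{0\}$, so the sum is at most $2\|\hat
F\|_{L^1}$. Its terms dominate the sup norms of the blocks. -/
theorem summable_integral_norm_phi_mul (F : 𝓢(Plane, ℂ)) :
    Summable fun k => ∫ ξ, ‖(ψ.phi k ξ : ℂ) * 𝓕 (F : Plane → ℂ) ξ‖ := by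
  have hF : ∫⁻ ξ, ‖𝓕 (F : Plane → ℂ) ξ‖ₑ ≠ ⊤ :=
    (hasFiniteIntegral_iff_enorm.1 (𝓕 F : 𝓢(Plane, ℂ)).integrable.2).ne
  have h1 : ∑' k, ∫⁻ ξ, ‖(ψ.phi k ξ : ℂ) * 𝓕 (F : Plane → ℂ) ξ‖ₑ ≠ ⊤ := by
    rw [← lintegral_tsum fun k => (ψ.integrable_phi_mul k F).1.enorm]
    have h2 : ∫⁻ ξ, ∑' k, ‖(ψ.phi k ξ : ℂ) * 𝓕 (F : Plane → ℂ) ξ‖ₑ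
        ≤ ∫⁻ ξ, 2 * ‖𝓕 (F : Plane → ℂ) ξ‖ₑ := by
      refine lintegral_mono_ae ?_
      filter_upwards [Measure.ae_ne volume (0 : Plane)] with ξ hξ
      simp only [enorm_mul]
      rw [ENNReal.tsum_mul_right]
      exact mul_le_mul' (ψ.tsum_enorm_phi_le hξ) le_rfl
    refine ne_top_of_le_ne_top ?_ h2
    rw [lintegral_const_mul' _ _ ENNReal.ofNat_ne_top]
    exact ENNReal.mul_ne_top ENNReal.ofNat_ne_top hF
  refine (ENNReal.summable_toReal h1).congr fun k => ?_
  rw [integral_norm_eq_lintegral_enorm (ψ.integrable_phi_mul k F).1]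

theorem norm_block_ofSchwartz_le (k : ℤ) (F : 𝓢(Plane, ℂ)) (x : Plane) :
    ‖ψ.block k (ofSchwartz F) x‖ ≤ ∫ ξ, ‖(ψ.phi k ξ : ℂ) * 𝓕 (F : Plane → ℂ) ξ‖ := by
  rw [block_ofSchwartz]
  refine (norm_integral_le_integral_norm _).trans (le_of_eq ?_)
  simp only [Circle.norm_smul]

theorem hasSum_block_ofSchwartz (F : 𝓢(Plane, ℂ)) (x : Plane) :
    HasSum (fun k => ψ.block k (ofSchwartz F) x) (F x) := by
  have hint : ∀ k, Integrable fun ξ =>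
      Real.fourierChar (inner ℝ ξ x) • ((ψ.phi k ξ : ℂ) * 𝓕 (F : Plane → ℂ) ξ) := by
    intro k
    have h := ψ.integrable_phi_mul k F
    refine h.norm.mono' ?_ (Eventually.of_forall fun ξ => by rw [Circle.norm_smul])
    have hc : Continuous fun ξ : Plane => Real.fourierChar (inner ℝ ξ x) :=
      Real.continuous_fourierChar.comp (by fun_prop)
    exact hc.aestronglyMeasurable.smul h.1
  have h := hasSum_integral_of_summable_integral_norm hint
    (by simpa only [Circle.norm_smul] using ψ.summable_integral_norm_phi_mul F)
  simp only [block_ofSchwartz]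
  convert! h using 1
  have h1 : F x = 𝓕⁻ (𝓕 F : 𝓢(Plane, ℂ)) x := by
    rw [FourierTransform.fourierInv_fourier_eq]
  rw [h1, SchwartzMap.fourierInv_coe, Real.fourierInv_eq]
  refine integral_congr_ae ?_
  filter_upwards [Measure.ae_ne volume (0 : Plane)] with ξ hξ
  have h2 := ((ψ.hasSum_phi hξ).mul_right (𝓕 (F : Plane → ℂ) ξ)).const_smul
    (Real.fourierChar (inner ℝ ξ x))
  rw [h2.tsum_eq, one_mul]
  rfl

/-! ### The commutator of Schwartz functions -/

theorem hasSum_blockFun {ι : Type*} [Countable ι] (j : ℤ) (x : Plane) {w : ι → Plane → ℂ}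
    {W : Plane → ℂ} {N : ι → ℝ} (hc : ∀ i, Continuous (w i)) (hN : Summable N)
    (hb : ∀ i y, ‖w i y‖ ≤ N i) (hW : ∀ y, HasSum (fun i => w i y) (W y)) :
    HasSum (fun i => ψ.blockFun j (w i) x) (ψ.blockFun j W x) := by
  have hint : ∀ i, Integrable fun y => ψ.kernel j (x - y) * w i y :=
    fun i => ψ.integrable_kernel_mul j x (hc i) (hb i)
  have hk : Integrable fun y => ψ.kernel j (x - y) :=
    (ψ.kernel j).integrable.comp_sub_left x
  have h := hasSum_integral_of_summable_integral_norm hint ?_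
  · convert! h using 1
    rw [blockFun]
    congr 1 with y
    rw [tsum_mul_left, (hW y).tsum_eq]
  · refine Summable.of_nonneg_of_le (fun i => by positivity) (fun i => ?_)
      (hN.mul_left (∫ y, ‖ψ.kernel j (x - y)‖))
    rw [← integral_mul_const]
    refine integral_mono (hint i).norm (hk.norm.mul_const _) fun y => ?_
    dsimp only
    rw [norm_mul]
    exact mul_le_mul_of_nonneg_left (hb i y) (norm_nonneg _)

/-- The two halves of the commutator are summed separately: the first is dominated by the summable
products $M_kN_l$ of block sup bounds, the second is a product of two absolutely convergent series.
-/
theorem hasSum_commTerm_ofSchwartz (F G : 𝓢(Plane, ℂ)) (j : ℤ) (x : Plane) :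
    HasSum (fun kl => ψ.commTerm j (ofSchwartz F) (ofSchwartz G) kl x) (ψ.commFun j F G x) := by
  set M := fun k => ∫ ξ, ‖(ψ.phi k ξ : ℂ) * 𝓕 (F : Plane → ℂ) ξ‖
  set N := fun l => ∫ ξ, ‖(ψ.phi l ξ : ℂ) * 𝓕 (G : Plane → ℂ) ξ‖
  have hM : Summable M := ψ.summable_integral_norm_phi_mul F
  have hN : Summable N := ψ.summable_integral_norm_phi_mul G
  have hM0 : 0 ≤ M := fun k => integral_nonneg fun ξ => norm_nonneg _
  have hN0 : 0 ≤ N := fun l => integral_nonneg fun ξ => norm_nonneg _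
  have h1 : HasSum (fun kl : ℤ × ℤ => ψ.blockFun j
      (fun y => ψ.block kl.1 (ofSchwartz F) y * ψ.block kl.2 (ofSchwartz G) y) x)
      (ψ.blockFun j (fun y => F y * G y) x) := by
    refine ψ.hasSum_blockFun j x (N := fun kl => M kl.1 * N kl.2)
      (fun kl => (ψ.continuous_block _ _).mul (ψ.continuous_block _ _))
      (hM.mul_of_nonneg hN hM0 hN0) (fun kl y => ?_) fun y => ?_
    · rw [norm_mul]
      exact mul_le_mul (ψ.norm_block_ofSchwartz_le _ F y) (ψ.norm_block_ofSchwartz_le _ G y)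
        (norm_nonneg _) (hM0 _)
    · have h := hasSum_prod_mul (ψ.hasSum_block_ofSchwartz F y) (ψ.hasSum_block_ofSchwartz G y)
      exact h
  have h2 : HasSum (fun l => ψ.blockFun j (ψ.block l (ofSchwartz G)) x) (ψ.blockFun j G x) :=
    ψ.hasSum_blockFun j x (fun l => ψ.continuous_block l _) hN
      (fun l => ψ.norm_block_ofSchwartz_le l G) (ψ.hasSum_block_ofSchwartz G)
  have h3 := hasSum_prod_mul (ψ.hasSum_block_ofSchwartz F x) h2
  exact h1.sub h3

end Bump

end LittlewoodPaley

end

/-! ### The commutator estimate with a normalized sequence $(c_j)$. -/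

theorem mainTheorem3 (ψ : LittlewoodPaley.Bump) (p : ℝ) (q : ℝ≥0∞) (s t : ℝ)
    (hp : 1 < p) (hq : 1 ≤ q)
    (hs : 2 / p < s) (hs' : s < 1 + 2 / p) (ht : t < 2 / p) (hst : 2 / p < s + t) :
    (∃ C : ℝ≥0, ∀ f ∈ ψ.besov s (ENNReal.ofReal p) q, ∀ g ∈ ψ.besov t (ENNReal.ofReal p) q,
      ∃ c : ℤ → ℝ≥0, LittlewoodPaley.ellNorm q (fun j => (c j : ℝ≥0∞)) ≤ 1 ∧ ∀ j : ℤ,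
        (∀ x, Summable fun kl => ψ.commTerm j f g kl x) ∧
        MemLp (ψ.comm j f g) (ENNReal.ofReal p) volume ∧
        Tendsto (fun S : Finset (ℤ × ℤ) => eLpNorm
          (fun x => (∑ kl ∈ S, ψ.commTerm j f g kl x) - ψ.comm j f g x) (ENNReal.ofReal p) volume)
          atTop (𝓝 0) ∧
        eLpNorm (ψ.comm j f g) (ENNReal.ofReal p) volume ≤
          C * (2 : ℝ≥0∞) ^ (-(s + t - 2 / p) * (j : ℝ)) * c j
            * ψ.besovNorm s (ENNReal.ofReal p) q f * ψ.besovNorm t (ENNReal.ofReal p) q g) ∧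
    (∀ (F G : 𝓢(LittlewoodPaley.Plane, ℂ)) (j : ℤ) (x : LittlewoodPaley.Plane),
      HasSum (fun kl => ψ.commTerm j (LittlewoodPaley.ofSchwartz F)
        (LittlewoodPaley.ofSchwartz G) kl x) (ψ.commFun j F G x)) := by
  refine ⟨?_, ψ.hasSum_commTerm_ofSchwartz⟩
  obtain ⟨C, hC⟩ := ψ.exists_comm_bound hp hq hs hs' ht hst
  refine ⟨C, fun f hf g hg => ?_⟩
  obtain ⟨hsum, hmem, hlim, hnorm⟩ := hC f hf g hg
  have hM : C * (ψ.besovNorm s (ENNReal.ofReal p) q f * ψ.besovNorm t (ENNReal.ofReal p) q g)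
      ≠ ⊤ := ENNReal.mul_ne_top ENNReal.coe_ne_top (ENNReal.mul_ne_top
    (show ψ.besovNorm s (ENNReal.ofReal p) q f < ⊤ from hf).ne
    (show ψ.besovNorm t (ENNReal.ofReal p) q g < ⊤ from hg).ne)
  obtain ⟨c, hc, hcj⟩ := LittlewoodPaley.exists_le_mul_of_ellNorm_le hq hM hnorm
  refine ⟨c, hc, fun j => ⟨hsum j, hmem j, hlim j, ?_⟩⟩
  have h1 : (2 : ℝ≥0∞) ^ (-(s + t - 2 / p) * (j : ℝ))
      * (2 : ℝ≥0∞) ^ ((s + t - 2 / p) * (j : ℝ)) = 1 := by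
    rw [LittlewoodPaley.two_rpow_mul_two_rpow, ← ENNReal.rpow_zero (x := 2)]
    congr 1
    ring
  calc _ = (2 : ℝ≥0∞) ^ (-(s + t - 2 / p) * (j : ℝ)) * ((2 : ℝ≥0∞) ^ ((s + t - 2 / p) * (j : ℝ))
        * eLpNorm (ψ.comm j f g) (ENNReal.ofReal p) volume) := by rw [← mul_assoc, h1, one_mul]
    _ ≤ (2 : ℝ≥0∞) ^ (-(s + t - 2 / p) * (j : ℝ)) * _ := mul_le_mul' le_rfl (hcj j)
    _ = _ := by ring
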